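/- Definitions. A convex polyhedron in $\mathbb{R}^d$ is a compact set with nonempty interior defined by finitely many linear inequalities; a polyhedral set is a union of finitely many convex polyhedra. A self-affine tiling of a compact set $G\subset\mathbb{R}^d$ of positive Lebesgue measure is a finite family $\mathcal{T}=\{T_i\}_{i=1}^N$ of compact sets with $G=\bigcup_i T_i$ that are translates of each other and have pairwise intersections of Lebesgue measure zero, together with affine transforms $A_i$ of $\mathbb{R}^d$ such that $A_i(T_i)=G$ for all $i$ and all $A_i$ have one and the same linear part $M$, all of whose (complex) eigenvalues are bigger than one in absolute value. For a polyhedral set $G$ and $v\in G$, the corner of $G$ at $v$ is the intersection of $G$ with a sufficiently small ball centered at $v$, and its extension is the cone $K$ with apex $v$ that coincides with $G$ in that ball, i.e. $K=\{x : v+t(x-v)\in G \text{ for all sufficiently small } t>0\}$. A vertex $v$ of the convex hull $\mathrm{co}(G)$ is called a stationary vertex of $G$ (with respect to $\mathcal{T}$) if for the tile $T_i$ containing $v$ (it is unique) one has: 1) $A_i v=v$; 2) $A_i(K)=K$ and $A_i(F)=F$ for every face $F$ of the convex cone $\mathrm{co}(K)$; 3) $G\subset K$. A cone is called simple if it is affinely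 equivalent to the positive orthant $\mathbb{R}^d_+$. Proposition. Let $G\subset\mathbb{R}^d$ be a polyhedral set with a self-affine tiling $\mathcal{T}$, and let $v$ be a stationary vertex of $G$ with respect to $\mathcal{T}$. Then the corner of $G$ at $v$ is convex and simple: its extension $K$ is a convex simple cone, and $G$ coincides with $K$ in some ball of positive radius centered at $v$. -/

import Mathlib

open Set Filter Topology MeasureTheory

/-- A convex polyhedron: a compact set with nonempty interior that is the solution set of
finitely many (non-strict) linear inequalities. -/
def IsConvexPolyhedron {d : ℕ} (P : Set (EuclideanSpace ℝ (Fin d))) : Prop :=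
  IsCompact P ∧ (interior P).Nonempty ∧
    ∃ (m : ℕ) (a : Fin m → EuclideanSpace ℝ (Fin d)) (b : Fin m → ℝ),
      P = {x | ∀ k, inner ℝ (a k) x ≤ b k}

/-- A polyhedral set: a union of finitely many convex polyhedra. -/
def IsPolyhedralSet {d : ℕ} (G : Set (EuclideanSpace ℝ (Fin d))) : Prop :=
  ∃ (n : ℕ) (P : Fin n → Set (EuclideanSpace ℝ (Fin d))),
    (∀ k, IsConvexPolyhedron (P k)) ∧ G = ⋃ k, P k

/-- A finite tiling of a closed set `G` of positive Lebesgue measure: compact sets with union `G`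
that are translates of each other and whose pairwise intersections are Lebesgue null. -/
structure IsTiling {d N : ℕ} (G : Set (EuclideanSpace ℝ (Fin d)))
    (T : Fin N → Set (EuclideanSpace ℝ (Fin d))) : Prop where
  isClosed : IsClosed G
  volume_pos : 0 < volume G
  isCompact : ∀ i, IsCompact (T i)
  iUnion_eq : ⋃ i, T i = G
  translate : ∀ i j, ∃ a : EuclideanSpace ℝ (Fin d), T j = (fun x => x + a) '' T i
  null_inter : ∀ i j, i ≠ j → volume (T i ∩ T j) = 0

/-- A linear operator is expanding if all its (complex) eigenvalues are bigger than one in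
absolute value. -/
def IsExpanding {d : ℕ}
    (M : EuclideanSpace ℝ (Fin d) →ₗ[ℝ] EuclideanSpace ℝ (Fin d)) : Prop :=
  ∀ μ : ℂ, (M.charpoly.map (algebraMap ℝ ℂ)).IsRoot μ → 1 < ‖μ‖

/-- A self-affine tiling of `G`: a tiling `T` together with affine transforms `A i : T i → G`
(onto `G`) that have a common expanding linear part (the dilation matrix). -/
structure IsSelfAffineTiling {d N : ℕ} (G : Set (EuclideanSpace ℝ (Fin d)))
    (T : Fin N → Set (EuclideanSpace ℝ (Fin d)))
    (A : Fin N → (EuclideanSpace ℝ (Fin d) →ᵃ[ℝ] EuclideanSpace ℝ (Fin d))) : Prop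
    extends IsTiling G T where
  image_eq : ∀ i, A i '' T i = G
  dilation : ∃ M : EuclideanSpace ℝ (Fin d) →ₗ[ℝ] EuclideanSpace ℝ (Fin d),
    IsExpanding M ∧ ∀ i, (A i).linear = M

/-- The extension of the corner of `G` at `v`: the cone with apex `v` consisting of all `x` such
that the segment from `v` towards `x` starts inside `G`. For a polyhedral set `G` and `v ∈ G` this
is the cone that coincides with `G` in all small balls centered at `v`. -/
def cornerCone {d : ℕ} (G : Set (EuclideanSpace ℝ (Fin d))) (v : EuclideanSpace ℝ (Fin d)) :
    Set (EuclideanSpace ℝ (Fin d)) :=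
  {x | ∀ᶠ t : ℝ in 𝓝[>] 0, v + t • (x - v) ∈ G}

/-- `v` is a stationary vertex of `G` (with respect to the self-affine tiling `T` with the affine
transforms `A i : T i → G`): it is an extreme vertex of `G`, i.e. a vertex of the convex hull of
`G`, and the tile `T i` containing `v` (there is only one) satisfies: `A i` fixes `v`, it maps the
corner `K` of `G` at `v` and every face of `co K` onto itself, and `G` lies in the extension
of `K`. -/
def IsStationaryVertex {d N : ℕ} (G : Set (EuclideanSpace ℝ (Fin d)))
    (T : Fin N → Set (EuclideanSpace ℝ (Fin d)))
    (A : Fin N → (EuclideanSpace ℝ (Fin d) →ᵃ[ℝ] EuclideanSpace ℝ (Fin d)))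
    (v : EuclideanSpace ℝ (Fin d)) : Prop :=
  v ∈ (convexHull ℝ G).extremePoints ℝ ∧
    ∃ i, v ∈ T i ∧ A i v = v ∧
      A i '' cornerCone G v = cornerCone G v ∧
      (∀ F, IsExposed ℝ (convexHull ℝ (cornerCone G v)) F → A i '' F = F) ∧
      G ⊆ cornerCone G v

/-- A cone is simple if it is affinely equivalent to the positive orthant. -/
def IsSimpleCone {d : ℕ} (C : Set (EuclideanSpace ℝ (Fin d))) : Prop :=
  ∃ e : EuclideanSpace ℝ (Fin d) ≃ᵃ[ℝ] EuclideanSpace ℝ (Fin d),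
    e '' C = {y | ∀ k, 0 ≤ y k}

/-! Put `v` at the origin and let `K` be the cone agreeing with `G` near it, a priori only a finite
union of convex cones. With `B = M⁻¹` the tiling reads `1_G (B x) = ∑ 1_G (x - d i)` a.e. Since `v`
is extreme in `co G`, some functional `l` is positive on `K \ {0}`. Iterates of `B` carry each slice
`l < H` of `K` into the ball where `G` and `K` agree, so there `1_K` is a sum of translates of
`1_G`. All these translates but one are shifted up along `l`, so the relation can be inverted: below
any height, `1_G` is a finite combination of translates of `1_K`. Such translates are linearly
independent as germs (`coeff_eq_zero_of_ae_eq_zero`). Hence the apexes lie in `G`, the coefficients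
do not depend on the height, and one finite combination `1_G = ∑ r w * 1_K (x - w)` holds everywhere
(`IsConeTile.exists_finsupp`).

Now take Laplace transforms in dimension `n`. The transform of `G` is `∑ r w * exp (-s w)` times
that of `K`, and the latter is homogeneous of degree `-n`. Replacing `s` by `ε s` and letting `ε →
0` shows that the transform of `K` is `vol G / p` with `p` a form of degree `n`
(`momentForm_mul_laplace`). The transform diverges on the boundary of the dual cone, so `p` vanishes
on the hyperplane spanned by each of its facets. These hyperplanes include `n` independent ones, as
`K` has interior, and degree `n` leaves room for no more. So `p` is a product of `n` linear forms
and the dual cone is simple (`exists_basis`). Thus `K` sits in a simple cone whose transform is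
proportional to its own, and uniqueness of the Laplace transform makes the two equal
(`basisCone_subset_of_laplace`). -/

/-! ### Polyhedral sets and their germs at a point. -/

section Polyhedra

variable {E : Type*} [NormedAddCommGroup E] [NormedSpace ℝ E]

/-- `G` coincides with a cone with apex `u` in a neighbourhood of `u`. -/
def LocallyConic (G : Set E) (u : E) : Prop :=
  ∃ r : ℝ, 0 < r ∧ ∀ y, ‖y‖ < r → ∀ t : ℝ, 0 < t → t ≤ 1 → (u + t • y ∈ G ↔ u + y ∈ G)

/-- The cone of all directions that start inside `G` at the origin. -/
def germCone (G : Set E) : Set E := {x | ∀ᶠ t : ℝ in 𝓝[>] 0, t • x ∈ G}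

/-- A closed set that is a finite union of convex cones with nonempty interiors, all generated by
vectors of the finite set `V`. -/
structure IsConicPolyhedralSet [MeasurableSpace E] (K : Set E) (V : Finset E) : Prop where
  zero_mem : (0 : E) ∈ K
  smul_mem : ∀ x ∈ K, ∀ t : ℝ, 0 < t → t • x ∈ K
  isClosed : IsClosed K
  locallyConic : ∀ u, LocallyConic K u
  gen_mem : ∀ e ∈ V, e ∈ K
  gen_ne_zero : ∀ e ∈ V, e ≠ 0
  exists_combo : ∀ x ∈ K, ∃ c : E → ℝ, (∀ e, 0 ≤ c e) ∧ x = ∑ e ∈ V, c e • e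
  exists_piece : ∀ x ∈ K, ∃ C ⊆ K, x ∈ C ∧ MeasurableSet C ∧
    (∀ y ∈ C, ∀ t : ℝ, 0 < t → t • y ∈ C) ∧ (∀ y ∈ C, ∀ z ∈ C, y + z ∈ C) ∧
    (interior C).Nonempty

lemma LocallyConic.inter {ι : Type*} [Finite ι] {P : ι → Set E} {u : E}
    (h : ∀ k, LocallyConic (P k) u) : LocallyConic {x | ∀ k, x ∈ P k} u := by
  choose r hr h using h
  cases nonempty_fintype ι
  obtain ⟨ρ, hρ, hle⟩ : ∃ ρ : ℝ, 0 < ρ ∧ ∀ k, ρ ≤ r k := by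
    have := Filter.eventually_all.2 fun k => Ioc_mem_nhdsGT (hr k)
    obtain ⟨ρ, hρ⟩ := (this.and self_mem_nhdsWithin).exists
    exact ⟨ρ, hρ.2, fun k => (hρ.1 k).2⟩
  exact ⟨ρ, hρ, fun y hy t ht ht1 =>
    forall_congr' fun k => h k y (hy.trans_le (hle k)) t ht ht1⟩

/-- Local conicity passes to complements, which reduces unions to intersections. -/
lemma LocallyConic.iUnion {ι : Type*} [Finite ι] {P : ι → Set E} {u : E}
    (h : ∀ k, LocallyConic (P k) u) : LocallyConic (⋃ k, P k) u := by
  have hc : ∀ k, LocallyConic (P k)ᶜ u := fun k => by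
    obtain ⟨r, hr, h⟩ := h k
    exact ⟨r, hr, fun y hy t ht ht1 => not_congr (h y hy t ht ht1)⟩
  obtain ⟨r, hr, h⟩ := LocallyConic.inter hc
  refine ⟨r, hr, fun y hy t ht ht1 => ?_⟩
  have := not_congr (h y hy t ht ht1)
  simpa using this

lemma locallyConic_halfSpace (f : E →L[ℝ] ℝ) (b : ℝ) (u : E) :
    LocallyConic {x | f x ≤ b} u := by
  rcases lt_trichotomy (f u) b with h | h | h
  · have hc : ContinuousAt (fun y => f (u + y)) 0 := by fun_prop
    have h0 : ∀ᶠ y in 𝓝 (0 : E), f (u + y) < b :=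
      hc.eventually (Iio_mem_nhds (by simpa using h))
    obtain ⟨r, hr, hb⟩ := Metric.eventually_nhds_iff_ball.1 h0
    refine ⟨r, hr, fun y hy t ht ht1 => ?_⟩
    have h1 := hb y (by simpa using hy)
    have h2 := hb (t • y) (by
      rw [mem_ball_zero_iff, norm_smul, Real.norm_of_nonneg ht.le]
      nlinarith [norm_nonneg y])
    exact ⟨fun _ => h1.le, fun _ => h2.le⟩
  · refine ⟨1, one_pos, fun y _ t ht _ => ?_⟩
    simp only [mem_ofPred_eq, map_add, map_smul, smul_eq_mul, h]
    constructor <;> intro h' <;> nlinarith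
  · have hc : ContinuousAt (fun y => f (u + y)) 0 := by fun_prop
    have h0 : ∀ᶠ y in 𝓝 (0 : E), b < f (u + y) :=
      hc.eventually (Ioi_mem_nhds (by simpa using h))
    obtain ⟨r, hr, hb⟩ := Metric.eventually_nhds_iff_ball.1 h0
    refine ⟨r, hr, fun y hy t ht ht1 => ?_⟩
    have h1 := hb y (by simpa using hy)
    have h2 := hb (t • y) (by
      rw [mem_ball_zero_iff, norm_smul, Real.norm_of_nonneg ht.le]
      nlinarith [norm_nonneg y])
    exact ⟨fun h => absurd h (not_le.2 h2), fun h => absurd h (not_le.2 h1)⟩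

lemma locallyConic_polyhedron {ι : Type*} [Finite ι] (f : ι → E →L[ℝ] ℝ) (b : ι → ℝ) (u : E) :
    LocallyConic {x | ∀ k, f k x ≤ b k} u :=
  LocallyConic.inter (P := fun k => {x | f k x ≤ b k}) fun _ => locallyConic_halfSpace _ _ _

lemma convex_polyhedron {ι : Type*} (f : ι → E →L[ℝ] ℝ) (b : ι → ℝ) :
    Convex ℝ {x | ∀ k, f k x ≤ b k} := by
  intro x hx y hy s t hs ht hst k
  have h1 := hx k
  have h2 := hy k
  simp only [map_add, map_smul, smul_eq_mul]
  calc s * f k x + t * f k y ≤ s * b k + t * b k := by gcongr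
    _ = b k := by rw [← add_mul, hst, one_mul]

/-- An extreme point is determined by its active constraints: if `x ≠ y` have the same ones, then `x
± ε • (x - y)` stays feasible for small `ε`. -/
lemma finite_extremePoints_polyhedron {ι : Type*} [Finite ι] (f : ι → E →L[ℝ] ℝ) (b : ι → ℝ) :
    ({x | ∀ k, f k x ≤ b k}.extremePoints ℝ).Finite := by
  refine Set.Finite.of_finite_image (f := fun x => {k | f k x = b k}) (Set.toFinite _) ?_
  intro x hx y hy hxy
  by_contra hne
  have hact : ∀ k, f k x = b k → f k (x - y) = 0 := fun k hk => by
    have : f k y = b k := (Set.ext_iff.1 hxy k).1 hk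
    rw [map_sub, hk, this, sub_self]
  have key : ∀ k, ∀ᶠ ε : ℝ in 𝓝[>] 0, f k (x + ε • (x - y)) ≤ b k ∧
      f k (x - ε • (x - y)) ≤ b k := fun k => by
    rcases (hx.1 k).eq_or_lt with h | h
    · refine Eventually.of_forall fun ε => ?_
      rw [map_add, map_sub, map_smul, hact k h, h]
      simp
    · have hc1 : ContinuousAt (fun ε : ℝ => f k (x + ε • (x - y))) 0 := by fun_prop
      have hc2 : ContinuousAt (fun ε : ℝ => f k (x - ε • (x - y))) 0 := by fun_prop
      have h1 := hc1.eventually (show ∀ᶠ z in 𝓝 _, z ≤ b k from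
        Iic_mem_nhds (by simpa using h))
      have h2 := hc2.eventually (show ∀ᶠ z in 𝓝 _, z ≤ b k from
        Iic_mem_nhds (by simpa using h))
      exact (h1.and h2).filter_mono nhdsWithin_le_nhds
  obtain ⟨ε, hε, hε0⟩ := ((Filter.eventually_all.2 key).and self_mem_nhdsWithin).exists
  have hmem : x ∈ openSegment ℝ (x + ε • (x - y)) (x - ε • (x - y)) :=
    ⟨1 / 2, 1 / 2, by norm_num, by norm_num, by norm_num, by module⟩
  have := hx.2 (fun k => (hε k).1) (fun k => (hε k).2) hmem
  have h0 : ε • (x - y) = 0 := by simpa using this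
  rcases smul_eq_zero.1 h0 with h | h
  · exact (ne_of_gt hε0) h
  · exact hne (sub_eq_zero.1 h)

lemma exists_finset_convexHull_eq {ι : Type*} [Finite ι] (f : ι → E →L[ℝ] ℝ) (b : ι → ℝ)
    (hc : IsCompact {x | ∀ k, f k x ≤ b k}) :
    ∃ W : Finset E, convexHull ℝ (W : Set E) = {x | ∀ k, f k x ≤ b k} := by
  have hfin := finite_extremePoints_polyhedron f b
  refine ⟨hfin.toFinset, ?_⟩
  rw [Set.Finite.coe_toFinset, ← (hfin.isClosed_convexHull (𝕜 := ℝ)).closure_eq]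
  exact closure_convexHull_extremePoints hc (convex_polyhedron f b)

section GermCone

lemma mem_germCone {G : Set E} {x : E} :
    x ∈ germCone G ↔ ∀ᶠ t : ℝ in 𝓝[>] 0, t • x ∈ G := Iff.rfl

lemma smul_mem_germCone {G : Set E} {x : E} (hx : x ∈ germCone G) {t : ℝ} (ht : 0 < t) :
    t • x ∈ germCone G := by
  have : Tendsto (fun a : ℝ => a * t) (𝓝[>] 0) (𝓝[>] 0) := by
    refine tendsto_nhdsWithin_iff.2 ⟨?_, ?_⟩
    · have : ContinuousAt (fun a : ℝ => a * t) 0 := by fun_prop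
      simpa [ContinuousAt] using this.tendsto.mono_left nhdsWithin_le_nhds
    · filter_upwards [self_mem_nhdsWithin] with a ha
      exact mul_pos ha ht
  have := this.eventually hx
  simpa [germCone, smul_smul] using this

lemma smul_mem_germCone_iff {G : Set E} {x : E} {t : ℝ} (ht : 0 < t) :
    t • x ∈ germCone G ↔ x ∈ germCone G := by
  refine ⟨fun h => ?_, fun h => smul_mem_germCone h ht⟩
  simpa [smul_smul, ht.ne'] using smul_mem_germCone h (inv_pos.2 ht)

lemma LocallyConic.exists_mem_germCone_iff {G : Set E} (h : LocallyConic G 0) :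
    ∃ r : ℝ, 0 < r ∧ ∀ y, ‖y‖ < r → (y ∈ germCone G ↔ y ∈ G) := by
  obtain ⟨r, hr, h⟩ := h
  simp only [zero_add] at h
  refine ⟨r, hr, fun y hy => ⟨fun hK => ?_, fun hG => ?_⟩⟩
  · obtain ⟨t, ht, ht0⟩ := ((mem_germCone.1 hK).and (Ioc_mem_nhdsGT (zero_lt_one' ℝ))).exists
    exact (h y hy t ht0.1 ht0.2).1 ht
  · filter_upwards [Ioc_mem_nhdsGT (zero_lt_one' ℝ)] with t ht
    exact (h y hy t ht.1 ht.2).2 hG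

/-- By dilation invariance, `u` may be scaled into the ball where the cone equals `G`; the conicity
of `G` at `ε • u` is then transported back. -/
lemma locallyConic_germCone {G : Set E} (h : ∀ u, LocallyConic G u) (u : E) :
    LocallyConic (germCone G) u := by
  obtain ⟨r, hr, hK⟩ := (h 0).exists_mem_germCone_iff
  obtain ⟨ε, hε, hεu⟩ : ∃ ε : ℝ, 0 < ε ∧ ε * ‖u‖ < r / 2 := by
    refine ⟨r / 2 / (‖u‖ + 1), by positivity, ?_⟩
    rw [div_mul_eq_mul_div, div_lt_iff₀ (by positivity)]
    nlinarith [norm_nonneg u]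
  obtain ⟨r', hr', hu⟩ := h (ε • u)
  refine ⟨min r' (r / 2) / ε, by positivity, fun y hy t ht ht1 => ?_⟩
  rw [lt_div_iff₀ hε, lt_min_iff] at hy
  have hny : ‖ε • y‖ = ‖y‖ * ε := by rw [norm_smul, Real.norm_of_nonneg hε.le, mul_comm]
  have hn : ∀ t : ℝ, 0 < t → t ≤ 1 → ‖ε • u + t • ε • y‖ < r := fun t ht ht1 => by
    calc ‖ε • u + t • ε • y‖ ≤ ‖ε • u‖ + ‖t • ε • y‖ := norm_add_le _ _
      _ = ε * ‖u‖ + t * (‖y‖ * ε) := by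
        rw [norm_smul, norm_smul t, Real.norm_of_nonneg hε.le, Real.norm_of_nonneg ht.le, hny]
      _ < r := by nlinarith [norm_nonneg y, mul_nonneg (norm_nonneg y) hε.le]
  have e1 : ε • (u + t • y) = ε • u + t • ε • y := by module
  have e2 : ε • (u + y) = ε • u + ε • y := by module
  have hn1 : ‖ε • u + ε • y‖ < r := by simpa using hn 1 one_pos le_rfl
  rw [← smul_mem_germCone_iff hε, e1, hK _ (hn t ht ht1), hu _ (by rw [hny]; exact hy.1) t ht ht1,
    ← hK _ hn1, ← e2, smul_mem_germCone_iff hε]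

lemma isClosed_germCone {G : Set E} (hG : IsClosed G) (h : LocallyConic G 0) :
    IsClosed (germCone G) := by
  obtain ⟨r, hr, hK⟩ := h.exists_mem_germCone_iff
  refine isClosed_of_closure_subset fun x hx => ?_
  obtain ⟨ε, hε, hεx⟩ : ∃ ε : ℝ, 0 < ε ∧ ε * ‖x‖ < r := by
    refine ⟨r / (‖x‖ + 1), by positivity, ?_⟩
    rw [div_mul_eq_mul_div, div_lt_iff₀ (by positivity)]
    nlinarith [norm_nonneg x]
  have hlt : ‖ε • x‖ < r := by rwa [norm_smul, Real.norm_of_nonneg hε.le]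
  rw [← smul_mem_germCone_iff hε, hK _ hlt]
  rw [mem_closure_iff_frequently] at hx
  refine hG.closure_eq ▸ mem_closure_iff_frequently.2 ?_
  have hcont : Tendsto (fun y : E => ε • y) (𝓝 x) (𝓝 (ε • x)) :=
    (continuous_const_smul ε).tendsto x
  refine hcont.frequently ?_
  refine (hx.and_eventually (hcont.eventually
    ((isOpen_lt continuous_norm continuous_const).mem_nhds hlt))).mono fun y hy => ?_
  exact (hK _ hy.2).1 (smul_mem_germCone hy.1 hε)

end GermCone

/-- Only the polyhedra through the origin matter for the germ. The cones over them are the convex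
pieces, and their nonzero vertices are the generators `V`. -/
theorem exists_isConicPolyhedralSet_germCone [MeasurableSpace E] [BorelSpace E] {n : ℕ}
    {m : Fin n → ℕ} (f : ∀ k, Fin (m k) → E →L[ℝ] ℝ) (b : ∀ k, Fin (m k) → ℝ)
    (hc : ∀ k, IsCompact {x | ∀ j, f k j x ≤ b k j})
    (hi : ∀ k, (interior {x | ∀ j, f k j x ≤ b k j}).Nonempty)
    {G : Set E} (hG : G = ⋃ k, {x | ∀ j, f k j x ≤ b k j})
    (h0 : (0 : E) ∈ (convexHull ℝ G).extremePoints ℝ) :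
    ∃ (V : Finset E) (l : E →L[ℝ] ℝ), IsConicPolyhedralSet (germCone G) V ∧
      (∀ e ∈ V, 0 < l e) ∧ LocallyConic G 0 := by
  classical
  set P : Fin n → Set E := fun k => {x | ∀ j, f k j x ≤ b k j} with hP
  have hconv : ∀ k, Convex ℝ (P k) := fun k => convex_polyhedron _ _
  have hlc : ∀ u, LocallyConic G u := fun u => by
    rw [hG]
    exact LocallyConic.iUnion fun k => locallyConic_polyhedron _ _ u
  have hPG : ∀ k, P k ⊆ G := fun k => hG ▸ subset_iUnion P k
  have hstar : ∀ k, (0 : E) ∈ P k → ∀ x ∈ P k, ∀ t : ℝ, 0 ≤ t → t ≤ 1 → t • x ∈ P k :=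
    fun k h0 x hx t ht ht1 => (hconv k).smul_mem_of_zero_mem h0 hx ⟨ht, ht1⟩
  have hsub : ∀ k, (0 : E) ∈ P k → ∀ x, ∀ t : ℝ, 0 < t → t • x ∈ P k → x ∈ germCone G := by
    intro k hk x t ht hx
    filter_upwards [Ioc_mem_nhdsGT ht] with a ha
    have := hstar k hk _ hx (a / t) (div_nonneg ha.1.le ht.le) ((div_le_one ht).2 ha.2)
    rw [smul_smul, div_mul_cancel₀ _ ht.ne'] at this
    exact hPG k this
  have hex : ∀ x ∈ germCone G, ∃ k, (0 : E) ∈ P k ∧ ∃ t : ℝ, 0 < t ∧ t • x ∈ P k := by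
    intro x hx
    have h1 : ∀ k, ∀ᶠ t : ℝ in 𝓝[>] 0, t • x ∈ P k → (0 : E) ∈ P k := fun k => by
      by_cases hk : (0 : E) ∈ P k
      · exact Eventually.of_forall fun _ _ => hk
      · have hcl : IsClosed (P k) := (hc k).isClosed
        have hct : Tendsto (fun t : ℝ => t • x) (𝓝 0) (𝓝 0) := by
          have : ContinuousAt (fun t : ℝ => t • x) 0 := by fun_prop
          simpa [ContinuousAt] using this
        filter_upwards [(hct.eventually (hcl.isOpen_compl.mem_nhds hk)).filter_mono
          nhdsWithin_le_nhds] with t ht ht'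
        exact absurd ht' ht
    obtain ⟨t, ⟨ht1, ht2⟩, ht3⟩ :=
      (((mem_germCone.1 hx).and (Filter.eventually_all.2 h1)).and self_mem_nhdsWithin).exists
    rw [hG] at ht1
    obtain ⟨k, hk⟩ := mem_iUnion.1 ht1
    exact ⟨k, ht2 k hk, t, ht3, hk⟩
  choose W hW using fun k => exists_finset_convexHull_eq (f k) (b k) (hc k)
  have hWP : ∀ k, ∀ e ∈ W k, e ∈ P k := fun k e he => by
    rw [hP]; dsimp only; rw [← hW k]; exact subset_convexHull ℝ _ he
  set V : Finset E := (Finset.univ.filter fun k => (0 : E) ∈ P k).biUnion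
    fun k => (W k).filter (· ≠ 0) with hV
  have hVmem : ∀ e, e ∈ V ↔ ∃ k, (0 : E) ∈ P k ∧ e ∈ W k ∧ e ≠ 0 := fun e => by
    simp [hV]
  obtain ⟨l, hl⟩ : ∃ l : E →L[ℝ] ℝ, ∀ e ∈ V, 0 < l e := by
    -- `V` lies in `co G` with its extreme point `0` removed, and the hull of that set misses `0`.
    have hnot : (0 : E) ∉ convexHull ℝ (V : Set E) := fun h => by
      have := ((convex_convexHull ℝ G).mem_extremePoints_iff_mem_sdiff_convexHull_sdiff).1 h0
      refine this.2 (convexHull_mono ?_ h)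
      intro e he
      obtain ⟨k, _, hk, hne⟩ := (hVmem e).1 he
      exact ⟨subset_convexHull ℝ _ (hPG k (hWP k e hk)), hne⟩
    obtain ⟨l, a, hla, hl⟩ := geometric_hahn_banach_point_closed (convex_convexHull ℝ (V : Set E))
      (V.finite_toSet.isClosed_convexHull (𝕜 := ℝ)) hnot
    refine ⟨l, fun e he => ?_⟩
    have := hl e (subset_convexHull ℝ _ he)
    rw [map_zero] at hla
    linarith
  have h0G : (0 : E) ∈ G := extremePoints_convexHull_subset h0
  refine ⟨V, l, ?_, hl, hlc 0⟩
  refine ⟨?_, fun x hx t ht => smul_mem_germCone hx ht, ?_, locallyConic_germCone hlc, ?_, ?_, ?_,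
    ?_⟩
  · exact mem_germCone.2 (Eventually.of_forall fun t => by simpa using h0G)
  · refine isClosed_germCone ?_ (hlc 0)
    rw [hG]
    exact isClosed_iUnion_of_finite fun k => (hc k).isClosed
  · intro e he
    obtain ⟨k, hk, hk', -⟩ := (hVmem e).1 he
    exact hsub k hk e 1 one_pos (by simpa using hWP k e hk')
  · intro e he
    exact ((hVmem e).1 he).choose_spec.2.2
  · intro x hx
    obtain ⟨k, hk, t, ht, htx⟩ := hex x hx
    rw [hP] at htx; dsimp only at htx
    rw [← hW k, Finset.mem_convexHull'] at htx
    obtain ⟨w, hw0, -, hwx⟩ := htx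
    refine ⟨fun e => if e ∈ W k then t⁻¹ * w e else 0, fun e => ?_, ?_⟩
    · dsimp only
      split_ifs with h
      · exact mul_nonneg (inv_pos.2 ht).le (hw0 e h)
      · exact le_rfl
    · have hsubV : (W k).filter (· ≠ 0) ⊆ V := fun e he => by
        rw [Finset.mem_filter] at he
        exact (hVmem e).2 ⟨k, hk, he⟩
      have : x = t⁻¹ • ∑ y ∈ W k, w y • y := by rw [hwx, smul_smul, inv_mul_cancel₀ ht.ne', one_smul]
      rw [this, Finset.smul_sum]
      have e1 : ∑ y ∈ W k, t⁻¹ • w y • y =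
          ∑ y ∈ (W k).filter (· ≠ 0), (if y ∈ W k then t⁻¹ * w y else 0) • y := by
        rw [Finset.sum_filter]
        refine Finset.sum_congr rfl fun y hy => ?_
        by_cases hy0 : y = 0
        · simp [hy0]
        · simp [hy0, hy, smul_smul]
      rw [e1]
      refine Finset.sum_subset hsubV fun y hy hy' => ?_
      have : y ∉ W k := fun h => hy' (Finset.mem_filter.2 ⟨h, ((hVmem y).1 hy).choose_spec.2.2⟩)
      simp [this]
  · intro x hx
    obtain ⟨k, hk, t, ht, htx⟩ := hex x hx
    refine ⟨{y | ∃ t : ℝ, 0 < t ∧ t • y ∈ P k}, ?_, ⟨t, ht, htx⟩, ?_, ?_, ?_, ?_⟩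
    · rintro y ⟨t, ht, hy⟩
      exact hsub k hk y t ht hy
    -- `P k` is star-shaped about `0`, so the scales `1 / (j + 1)` suffice and the cone is a
    -- countable union of closed sets.
    · have : {y | ∃ t : ℝ, 0 < t ∧ t • y ∈ P k} =
          ⋃ j : ℕ, (fun y : E => ((j : ℝ) + 1)⁻¹ • y) ⁻¹' P k := by
        ext y
        simp only [mem_ofPred_eq, mem_iUnion, mem_preimage]
        constructor
        · rintro ⟨t, ht, hy⟩
          obtain ⟨j, hj⟩ := exists_nat_one_div_lt ht
          rw [one_div] at hj
          refine ⟨j, ?_⟩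
          have := hstar k hk _ hy (((j : ℝ) + 1)⁻¹ / t) (by positivity)
            ((div_le_one ht).2 hj.le)
          rwa [smul_smul, div_mul_cancel₀ _ ht.ne'] at this
        · rintro ⟨j, hj⟩
          exact ⟨_, by positivity, hj⟩
      rw [this]
      refine MeasurableSet.iUnion fun j => ?_
      exact ((hc k).isClosed.preimage (continuous_const_smul _)).measurableSet
    · rintro y ⟨t, ht, hy⟩ a ha
      refine ⟨t / a, div_pos ht ha, ?_⟩
      rwa [smul_smul, div_mul_cancel₀ _ ha.ne']
    · rintro y ⟨t, ht, hy⟩ z ⟨t', ht', hz⟩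
      set τ := min t t' with hτ
      have hτ0 : 0 < τ := lt_min ht ht'
      have h1 : τ • y ∈ P k := by
        have := hstar k hk _ hy (τ / t) (by positivity) ((div_le_one ht).2 (min_le_left _ _))
        rwa [smul_smul, div_mul_cancel₀ _ ht.ne'] at this
      have h2 : τ • z ∈ P k := by
        have := hstar k hk _ hz (τ / t') (by positivity) ((div_le_one ht').2 (min_le_right _ _))
        rwa [smul_smul, div_mul_cancel₀ _ ht'.ne'] at this
      refine ⟨τ / 2, by positivity, ?_⟩
      have := hconv k h1 h2 (a := 1 / 2) (b := 1 / 2) (by norm_num) (by norm_num) (by norm_num)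
      convert! this using 1
      module
    · refine (hi k).mono (interior_mono fun y hy => ⟨1, one_pos, by rwa [one_smul]⟩)

end Polyhedra

/-! ### Elementary properties of polyhedral cones. -/

section Cones

variable {E : Type*} [NormedAddCommGroup E] [NormedSpace ℝ E]

open scoped Pointwise in
lemma exists_isOpen_subset_of_cone {C : Set E} (hC : ∀ y ∈ C, ∀ t : ℝ, 0 < t → t • y ∈ C)
    (hi : (interior C).Nonempty) {ε : ℝ} (hε : 0 < ε) :
    ∃ U : Set E, IsOpen U ∧ U.Nonempty ∧ U ⊆ C ∧ U ⊆ Metric.ball 0 ε := by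
  obtain ⟨x, hx⟩ := hi
  have ht : 0 < ε / (‖x‖ + 1) := by positivity
  refine ⟨((ε / (‖x‖ + 1)) • interior C) ∩ Metric.ball 0 ε,
    (isOpen_interior.smul₀ ht.ne').inter Metric.isOpen_ball,
    ⟨_, Set.smul_mem_smul_set hx, ?_⟩, ?_, inter_subset_right⟩
  · rw [mem_ball_zero_iff, norm_smul, Real.norm_of_nonneg ht.le, div_mul_eq_mul_div,
      div_lt_iff₀ (by positivity)]
    nlinarith [norm_nonneg x]
  · rintro _ ⟨⟨y, hy, rfl⟩, -⟩
    exact hC y (interior_subset hy) _ ht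

/-- The tangent cone of `K` at `u` is invariant under translation along `u`, because `u + t (y + c
u) = (1 + t c) (u + t / (1 + t c) y)`. -/
lemma add_smul_mem_germCone {K : Set E} (hK : ∀ x ∈ K, ∀ t : ℝ, 0 < t → t • x ∈ K) {u y : E}
    (hy : y ∈ germCone {z | u + z ∈ K}) (c : ℝ) : y + c • u ∈ germCone {z | u + z ∈ K} := by
  rw [mem_germCone] at hy ⊢
  have h1 : ContinuousAt (fun t : ℝ => t / (1 + t * c)) 0 := by
    refine ContinuousAt.div (by fun_prop) (by fun_prop) (by simp)
  have h2 : ∀ᶠ t : ℝ in 𝓝[>] 0, 0 < 1 + t * c := by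
    have : ContinuousAt (fun t : ℝ => 1 + t * c) 0 := by fun_prop
    exact (this.eventually (Ioi_mem_nhds (by simp))).filter_mono nhdsWithin_le_nhds
  have h3 : Tendsto (fun t : ℝ => t / (1 + t * c)) (𝓝[>] 0) (𝓝[>] 0) := by
    refine tendsto_nhdsWithin_iff.2 ⟨?_, ?_⟩
    · simpa [ContinuousAt] using h1.tendsto.mono_left nhdsWithin_le_nhds
    · filter_upwards [h2, self_mem_nhdsWithin] with t ht ht0
      exact div_pos ht0 ht
  filter_upwards [h3.eventually hy, h2] with t ht ht0
  have := hK _ ht _ ht0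
  rw [smul_add, smul_smul, mul_div_cancel₀ _ ht0.ne'] at this
  change u + t • (y + c • u) ∈ K
  convert! this using 1
  module

namespace IsConicPolyhedralSet

variable [MeasurableSpace E] {K : Set E} {V : Finset E} (hK : IsConicPolyhedralSet K V)
include hK

lemma smul_mem_iff {x : E} {t : ℝ} (ht : 0 < t) : t • x ∈ K ↔ x ∈ K := by
  refine ⟨fun h => ?_, fun h => hK.smul_mem x h t ht⟩
  simpa [smul_smul, ht.ne'] using hK.smul_mem _ h t⁻¹ (inv_pos.2 ht)

lemma nonneg {s : E →L[ℝ] ℝ} (hs : ∀ e ∈ V, 0 ≤ s e) {x : E} (hx : x ∈ K) : 0 ≤ s x := by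
  obtain ⟨c, hc, rfl⟩ := hK.exists_combo x hx
  simp only [map_sum, map_smul, smul_eq_mul]
  exact Finset.sum_nonneg fun e he => mul_nonneg (hc e) (hs e he)

lemma pos {s : E →L[ℝ] ℝ} (hs : ∀ e ∈ V, 0 < s e) {x : E} (hx : x ∈ K) (h0 : x ≠ 0) :
    0 < s x := by
  refine (hK.nonneg (fun e he => (hs e he).le) hx).lt_of_ne fun h => h0 ?_
  obtain ⟨c, hc, rfl⟩ := hK.exists_combo x hx
  simp only [map_sum, map_smul, smul_eq_mul] at h
  have := (Finset.sum_eq_zero_iff_of_nonneg fun e he => mul_nonneg (hc e) (hs e he).le).1 h.symm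
  refine Finset.sum_eq_zero fun e he => ?_
  rcases mul_eq_zero.1 (this e he) with h | h
  · simp [h]
  · exact absurd h (hs e he).ne'

lemma indicator_smul {x : E} {t : ℝ} (ht : 0 < t) :
    K.indicator (1 : E → ℝ) (t • x) = K.indicator (1 : E → ℝ) x := by
  by_cases h : x ∈ K
  · simp [h, (hK.smul_mem_iff ht).2 h]
  · simp [h, mt (hK.smul_mem_iff ht).1 h]

lemma exists_isOpen_subset {ε : ℝ} (hε : 0 < ε) :
    ∃ U : Set E, IsOpen U ∧ U.Nonempty ∧ U ⊆ K ∧ U ⊆ Metric.ball 0 ε := by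
  obtain ⟨C, hCK, -, -, hC, -, hi⟩ := hK.exists_piece 0 hK.zero_mem
  obtain ⟨U, h1, h2, h3, h4⟩ := exists_isOpen_subset_of_cone hC hi hε
  exact ⟨U, h1, h2, h3.trans hCK, h4⟩

end IsConicPolyhedralSet

end Cones

/-! ### Linear independence of germs of translated cones. -/

section Germs

variable {E : Type*} [NormedAddCommGroup E] [NormedSpace ℝ E] [FiniteDimensional ℝ E]
  [MeasurableSpace E] [BorelSpace E] {μ : Measure E} [μ.IsAddHaarMeasure]

omit [NormedSpace ℝ E] [FiniteDimensional ℝ E] in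
lemma ae_sub_right {p : E → Prop} (h : ∀ᵐ y ∂μ, p y) (u : E) : ∀ᵐ y ∂μ, p (y - u) :=
  (measurePreserving_sub_right μ u).quasiMeasurePreserving.ae h

lemma ae_smul_of_ae {p : E → Prop} (h : ∀ᵐ y ∂μ, p y) {t : ℝ} (ht : t ≠ 0) :
    ∀ᵐ y ∂μ, p (t • y) := by
  have : Measure.QuasiMeasurePreserving (fun y : E => t • y) μ μ := by
    refine ⟨measurable_const_smul t, ?_⟩
    rw [Measure.map_addHaar_smul μ ht]
    exact Measure.smul_absolutelyContinuous
  exact this.ae h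

/-- Functions that are positively homogeneous of degree zero and vanish near the origin vanish. -/
lemma ae_eq_zero_of_homogeneous {φ : E → ℝ} (hφ : ∀ y, ∀ t : ℝ, 0 < t → φ (t • y) = φ y) {ρ : ℝ}
    (hρ : 0 < ρ) (h : ∀ᵐ y ∂μ, ‖y‖ < ρ → φ y = 0) : ∀ᵐ y ∂μ, φ y = 0 := by
  have h1 : ∀ n : ℕ, ∀ᵐ y ∂μ, ‖((n : ℝ) + 1)⁻¹ • y‖ < ρ → φ (((n : ℝ) + 1)⁻¹ • y) = 0 :=
    fun n => ae_smul_of_ae h (by positivity)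
  filter_upwards [ae_all_iff.2 h1] with y hy
  obtain ⟨n, hn⟩ := exists_nat_gt (‖y‖ / ρ)
  have hn0 : (0 : ℝ) < (n : ℝ) + 1 := by positivity
  have := hy n (by
    rw [norm_smul, norm_inv, Real.norm_of_nonneg hn0.le, inv_mul_lt_iff₀ hn0]
    rw [div_lt_iff₀ hρ] at hn
    nlinarith)
  rwa [hφ _ _ (inv_pos.2 hn0)] at this

-- The difference operator `h y - h (y - u a)` kills the summand `g a` and preserves both the
-- invariance of the others and the vanishing on `l < 0`. Undoing it is harmless below height `l (u
-- a)`, where the shifted term is zero.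
omit [FiniteDimensional ℝ E] in
lemma exists_ae_eq_zero_of_sum_invariant (l : E →L[ℝ] ℝ) {ι : Type*} (I : Finset ι) (u : ι → E)
    (hu : ∀ i ∈ I, 0 < l (u i)) :
    ∀ (h : E → ℝ) (g : ι → E → ℝ), (∀ i ∈ I, ∀ y, g i (y - u i) = g i y) →
      (∀ᵐ y ∂μ, h y = ∑ i ∈ I, g i y) → (∀ y, l y < 0 → h y = 0) →
      ∃ ε : ℝ, 0 < ε ∧ ∀ᵐ y ∂μ, l y < ε → h y = 0 := by
  classical
  induction I using Finset.induction_on with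
  | empty =>
    intro h g _ hh _
    refine ⟨1, one_pos, ?_⟩
    filter_upwards [hh] with y hy _
    simpa using hy
  | insert a I ha ih =>
    intro h g hg hh h0
    have hua := hu a (Finset.mem_insert_self a I)
    obtain ⟨ε, hε, hz⟩ := ih (fun i hi => hu i (Finset.mem_insert_of_mem hi))
      (fun y => h y - h (y - u a)) (fun i y => g i y - g i (y - u a))
      (fun i hi y => by
        have h1 := hg i (Finset.mem_insert_of_mem hi)
        rw [h1, sub_right_comm, h1]) (by
        filter_upwards [hh, ae_sub_right hh (u a)] with y h1 h2
        rw [h1, h2, Finset.sum_insert ha, Finset.sum_insert ha,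
          hg a (Finset.mem_insert_self a I), Finset.sum_sub_distrib]
        ring) (fun y hy => by
        rw [h0 y hy, h0 (y - u a) (by rw [map_sub]; linarith), sub_zero])
    refine ⟨min ε (l (u a)), lt_min hε hua, ?_⟩
    filter_upwards [hz] with y hy hlt
    have h1 := hy (hlt.trans_le (min_le_left _ _))
    have h2 := h0 (y - u a) (by rw [map_sub]; linarith [min_le_right ε (l (u a))])
    linarith

namespace IsConicPolyhedralSet

/-- The translates of a pointed polyhedral cone are linearly independent as germs: near `v`, no
linear combination of translates can cancel the one with apex `v`. -/
theorem coeff_eq_zero_of_ae_eq_zero {K : Set E} {V : Finset E} (hK : IsConicPolyhedralSet K V)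
    {l : E →L[ℝ] ℝ} (hl : ∀ e ∈ V, 0 < l e) (W : Finset E) (r : E → ℝ) {v : E} {ρ : ℝ}
    (hρ : 0 < ρ) (h : ∀ᵐ x ∂μ, x ∈ Metric.ball v ρ →
      ∑ w ∈ W, r w * K.indicator (1 : E → ℝ) (x - w) = 0) (hv : v ∈ W) : r v = 0 := by
  classical
  -- `D w` is the tangent cone of `K` at `v - w`. Seen from `v`, the translate `w + K` is locally `D
  -- w`, which is invariant under `v - w`.
  set D : E → Set E := fun w => germCone {z | (v - w) + z ∈ K} with hD
  have hnear : ∀ w, ∃ r' : ℝ, 0 < r' ∧ ∀ y, ‖y‖ < r' → (y ∈ D w ↔ (v - w) + y ∈ K) := by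
    intro w
    have : LocallyConic {z | (v - w) + z ∈ K} 0 := by
      obtain ⟨r', hr', h'⟩ := hK.locallyConic (v - w)
      exact ⟨r', hr', fun y hy t ht ht1 => by simpa using h' y hy t ht ht1⟩
    exact this.exists_mem_germCone_iff
  have hfar : ∀ w, v - w ∉ K → ∃ r' : ℝ, 0 < r' ∧ ∀ y, ‖y‖ < r' → (v - w) + y ∉ K := by
    intro w hw
    have hc : ContinuousAt (fun y => (v - w) + y) 0 := by fun_prop
    have := hc.eventually (hK.isClosed.isOpen_compl.mem_nhds (by simpa using hw))
    obtain ⟨r', hr', hb⟩ := Metric.eventually_nhds_iff_ball.1 this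
    exact ⟨r', hr', fun y hy => hb y (by simpa using hy)⟩
  -- As `K` is closed, only apexes `w` with `v ∈ w + K` are visible near `v`; for them `l (v - w) >
  -- 0`.
  set I : Finset E := (W.erase v).filter fun w => v - w ∈ K with hI
  have hloc : ∀ w, ∃ r' : ℝ, 0 < r' ∧ ∀ y, ‖y‖ < r' →
      (y ∈ D w ↔ (v - w) + y ∈ K) ∧ (v - w ∉ K → (v - w) + y ∉ K) := by
    intro w
    obtain ⟨r1, h1, h1'⟩ := hnear w
    by_cases hw : v - w ∈ K
    · exact ⟨r1, h1, fun y hy => ⟨h1' y hy, fun h => absurd hw h⟩⟩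
    · obtain ⟨r2, h2, h2'⟩ := hfar w hw
      exact ⟨min r1 r2, lt_min h1 h2, fun y hy => ⟨h1' y (hy.trans_le (min_le_left _ _)),
        fun _ => h2' y (hy.trans_le (min_le_right _ _))⟩⟩
  choose R hR0 hR using hloc
  obtain ⟨δ, hδ, hδle⟩ : ∃ δ : ℝ, 0 < δ ∧ (∀ w ∈ W, δ ≤ R w) ∧ δ ≤ ρ := by
    have h1 := (Filter.eventually_all_finset W).2 fun w _ => Ioc_mem_nhdsGT (hR0 w)
    obtain ⟨δ, ⟨hδ, hδ'⟩, hδ0⟩ :=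
      ((h1.and (Ioc_mem_nhdsGT hρ)).and self_mem_nhdsWithin).exists
    exact ⟨δ, hδ0, fun w hw => (hδ w hw).2, hδ'.2⟩
  have hloc0 : ∀ᵐ y ∂μ, ‖y‖ < δ → r v * K.indicator (1 : E → ℝ) y -
      ∑ w ∈ I, -(r w * (D w).indicator (1 : E → ℝ) y) = 0 := by
    filter_upwards [ae_sub_right h (-v)] with y hy hyδ
    have h1 := hy (by
      rw [sub_neg_eq_add, mem_ball_iff_norm, add_sub_cancel_right]
      exact hyδ.trans_le hδle.2)
    rw [← Finset.add_sum_erase W _ hv, sub_neg_eq_add, add_sub_cancel_right] at h1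
    rw [Finset.sum_neg_distrib, sub_neg_eq_add, ← h1, hI, Finset.sum_filter]
    congr 1
    refine Finset.sum_congr rfl fun w hw => ?_
    have h2 := hR w y (hyδ.trans_le (hδle.1 w (Finset.mem_of_mem_erase hw)))
    have e : y + v - w = (v - w) + y := by abel
    rw [e]
    by_cases hwK : v - w ∈ K
    · rw [if_pos hwK]
      by_cases hyD : y ∈ D w
      · rw [indicator_of_mem hyD, indicator_of_mem (h2.1.1 hyD)]; rfl
      · rw [indicator_of_notMem hyD, indicator_of_notMem (mt h2.1.2 hyD)]
    · rw [if_neg hwK, indicator_of_notMem (h2.2 hwK), mul_zero]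
  -- The local identity involves only cones with apex `0`, so homogeneity makes it global; the
  -- shifts by `v - w` can then be used.
  have hall := ae_eq_zero_of_homogeneous (fun y t ht => by
    rw [hK.indicator_smul ht]
    congr 1
    refine Finset.sum_congr rfl fun w _ => ?_
    by_cases hy : y ∈ D w
    · rw [indicator_of_mem hy, indicator_of_mem (smul_mem_germCone hy ht)]; rfl
    · rw [indicator_of_notMem hy, indicator_of_notMem (mt (smul_mem_germCone_iff ht).1 hy)]) hδ hloc0
  obtain ⟨ε, hε, hz⟩ := exists_ae_eq_zero_of_sum_invariant (μ := μ) l I (fun w => v - w)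
    (fun w hw => by
      rw [hI, Finset.mem_filter, Finset.mem_erase] at hw
      exact hK.pos hl hw.2 (sub_ne_zero.2 (Ne.symm hw.1.1)))
    (fun y => r v * K.indicator (1 : E → ℝ) y)
    (fun w y => -(r w * (D w).indicator (1 : E → ℝ) y))
    (fun w _ y => by
      have hiff : y - (v - w) ∈ D w ↔ y ∈ D w := by
        constructor
        · intro hy
          simpa using add_smul_mem_germCone hK.smul_mem hy 1
        · intro hy
          have := add_smul_mem_germCone hK.smul_mem hy (-1)
          rwa [neg_one_smul, ← sub_eq_add_neg] at this
      by_cases hy : y ∈ D w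
      · rw [indicator_of_mem hy, indicator_of_mem (hiff.2 hy)]; rfl
      · rw [indicator_of_notMem hy, indicator_of_notMem (mt hiff.1 hy)])
    (by filter_upwards [hall] with y hy; linarith)
    (fun y hy => by
      have : y ∉ K := fun hyK => absurd (hK.nonneg (fun e he => (hl e he).le) hyK) (not_le.2 hy)
      simp [this])
  have hcont : ContinuousAt l 0 := l.continuous.continuousAt
  obtain ⟨δ', hδ', hb⟩ := Metric.eventually_nhds_iff_ball.1
    (hcont.eventually (Iio_mem_nhds (show l 0 < ε by simpa using hε)))
  -- `r v * 1_K` vanishes below height `ε`, but `K` contains open sets there.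
  obtain ⟨U, hUo, hUn, hUK, hUb⟩ := hK.exists_isOpen_subset hδ'
  by_contra hrv
  refine (hUo.measure_pos μ hUn).ne' (measure_mono_null (fun y hy => ?_) hz)
  simp only [mem_compl_iff, mem_ofPred_eq, Classical.not_imp]
  exact ⟨hb y (hUb hy), by simp [hUK hy, hrv]⟩

end IsConicPolyhedralSet

end Germs

/-! ### From the tiling to a finite combination of translated cones. -/

section Tilings

variable {E : Type*} [NormedAddCommGroup E] [NormedSpace ℝ E] [FiniteDimensional ℝ E]
  [MeasurableSpace E] [BorelSpace E] {μ : Measure E} [μ.IsAddHaarMeasure]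

lemma ae_continuousLinearEquiv {p : E → Prop} (h : ∀ᵐ y ∂μ, p y) (B : E ≃L[ℝ] E) :
    ∀ᵐ y ∂μ, p (B y) := by
  have : Measure.QuasiMeasurePreserving (fun y : E => B y) μ μ := by
    refine ⟨B.continuous.measurable, ?_⟩
    have hdet : LinearMap.det (B.toLinearEquiv : E →ₗ[ℝ] E) ≠ 0 :=
      (LinearEquiv.isUnit_det' B.toLinearEquiv).ne_zero
    have := Measure.map_linearMap_addHaar_eq_smul_addHaar μ hdet
    change Measure.map ((B.toLinearEquiv : E →ₗ[ℝ] E)) μ ≪ μ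
    rw [this]
    exact Measure.smul_absolutelyContinuous
  exact this.ae h

/-- A compact set `G` that agrees near the origin with the cone `K` containing it, and is tiled by
translates of its image under the contraction `B`, which preserves `K`. -/
structure IsConeTile (μ : Measure E) (K G : Set E) (B : E ≃L[ℝ] E) {ι : Type} [Fintype ι]
    (d : ι → E) (i₀ : ι) : Prop where
  isCompact : IsCompact G
  subset : G ⊆ K
  exists_ball : ∃ r : ℝ, 0 < r ∧ ∀ y, ‖y‖ < r → (y ∈ K ↔ y ∈ G)
  map_mem : ∀ x, B x ∈ K ↔ x ∈ K
  tendsto : ∀ R ε : ℝ, 0 < ε → ∃ n : ℕ, ∀ x, ‖x‖ ≤ R → ‖B^[n] x‖ < ε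
  zero_digit : d i₀ = 0
  digit_mem : ∀ i, d i ∈ K
  digit_ne_zero : ∀ i, i ≠ i₀ → d i ≠ 0
  cover : ∀ᵐ x ∂μ, G.indicator (1 : E → ℝ) (B x) = ∑ i, G.indicator (1 : E → ℝ) (x - d i)

omit [FiniteDimensional ℝ E] [MeasurableSpace E] [BorelSpace E] in
lemma norm_sum_smul_le {ι : Type*} {I : Finset ι} {v : ι → E} {s : E →L[ℝ] ℝ}
    (hs : ∀ i ∈ I, 0 < s (v i)) {c : ι → ℝ} (hc : ∀ i, 0 ≤ c i) :
    ‖∑ i ∈ I, c i • v i‖ ≤ (∑ i ∈ I, ‖v i‖ / s (v i)) * s (∑ i ∈ I, c i • v i) := by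
  calc ‖∑ i ∈ I, c i • v i‖ ≤ ∑ i ∈ I, ‖c i • v i‖ := norm_sum_le _ _
    _ = ∑ i ∈ I, (‖v i‖ / s (v i)) * (c i * s (v i)) := by
      refine Finset.sum_congr rfl fun i hi => ?_
      rw [norm_smul, Real.norm_of_nonneg (hc i)]
      field_simp [(hs i hi).ne']
    _ ≤ ∑ i ∈ I, (‖v i‖ / s (v i)) * s (∑ i ∈ I, c i • v i) := by
      refine Finset.sum_le_sum fun i hi => ?_
      refine mul_le_mul_of_nonneg_left ?_ (div_nonneg (norm_nonneg _) (hs i hi).le)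
      rw [map_sum]
      simp only [map_smul, smul_eq_mul]
      exact Finset.single_le_sum (f := fun i => c i * s (v i))
        (fun i hi => mul_nonneg (hc i) (hs i hi).le) hi
    _ = _ := by rw [Finset.sum_mul]

namespace IsConicPolyhedralSet

variable {K : Set E} {V : Finset E}

-- This bounds the slices `s < H` of `K` and later makes `exp (-s x)` integrable on `K`.
omit [FiniteDimensional ℝ E] [BorelSpace E] in
lemma exists_norm_le (hK : IsConicPolyhedralSet K V) {s : E →L[ℝ] ℝ} (hs : ∀ e ∈ V, 0 < s e) :
    ∃ c : ℝ, 0 < c ∧ ∀ x ∈ K, ‖x‖ ≤ c * s x := by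
  have h0 : 0 ≤ ∑ e ∈ V, ‖e‖ / s e :=
    Finset.sum_nonneg fun e he => div_nonneg (norm_nonneg e) (hs e he).le
  -- The `+ 1` keeps the constant positive when `V` is empty.
  refine ⟨∑ e ∈ V, ‖e‖ / s e + 1, by linarith, fun x hx => ?_⟩
  have hsx := hK.nonneg (fun e he => (hs e he).le) hx
  obtain ⟨c, hc, hxc⟩ := hK.exists_combo x hx
  have h1 := norm_sum_smul_le (I := V) (v := id) hs hc
  simp only [id_eq] at h1
  rw [← hxc] at h1
  linarith

end IsConicPolyhedralSet

namespace IsConeTile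

variable {K G : Set E} {V : Finset E} {B : E ≃L[ℝ] E} {ι : Type} [Fintype ι] {d : ι → E} {i₀ : ι}
  {l : E →L[ℝ] ℝ}

/-- The tiling relation is substituted into itself; the new shifts are `B⁻¹ (D k) + d i`. Since `K`
need not be convex, they are tracked in the additive monoid generated by `K`, where `l` is still
positive off `0`. -/
lemma exists_cover_iterate (hG : IsConeTile μ K G B d i₀) (hK : IsConicPolyhedralSet K V)
    (hl : ∀ e ∈ V, 0 < l e) (n : ℕ) :
    ∃ (κ : Type) (_ : Fintype κ) (D : κ → E) (k₀ : κ), D k₀ = 0 ∧ (∀ k, k ≠ k₀ → 0 < l (D k)) ∧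
      ∀ᵐ x ∂μ, G.indicator (1 : E → ℝ) (B^[n] x) = ∑ k, G.indicator (1 : E → ℝ) (x - D k) := by
  have hpos : ∀ x ∈ AddSubmonoid.closure K, x = 0 ∨ 0 < l x := by
    intro x hx
    induction hx using AddSubmonoid.closure_induction with
    | mem x hx =>
      by_cases h : x = 0
      · exact Or.inl h
      · exact Or.inr (hK.pos hl hx h)
    | zero => exact Or.inl rfl
    | add x y _ _ hx hy =>
      rcases hx with rfl | hx
      · simpa using hy
      · rcases hy with rfl | hy
        · simpa using Or.inr hx
        · right; rw [map_add]; positivity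
  have hB : ∀ x ∈ AddSubmonoid.closure K, B.symm x ∈ AddSubmonoid.closure K := by
    intro x hx
    induction hx using AddSubmonoid.closure_induction with
    | mem x hx =>
      exact AddSubmonoid.subset_closure ((hG.map_mem _).1 (by simpa using hx))
    | zero => simp
    | add x y _ _ hx hy => rw [map_add]; exact add_mem hx hy
  suffices h : ∃ (κ : Type) (_ : Fintype κ) (D : κ → E) (k₀ : κ), D k₀ = 0 ∧
      (∀ k, k ≠ k₀ → 0 < l (D k)) ∧ (∀ k, D k ∈ AddSubmonoid.closure K) ∧
      ∀ᵐ x ∂μ, G.indicator (1 : E → ℝ) (B^[n] x) = ∑ k, G.indicator (1 : E → ℝ) (x - D k) by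
    obtain ⟨κ, hκ, D, k₀, h1, h2, -, h3⟩ := h
    exact ⟨κ, hκ, D, k₀, h1, h2, h3⟩
  induction n with
  | zero => exact ⟨Unit, inferInstance, fun _ => 0, (), rfl, fun k hk => absurd rfl hk,
      fun _ => zero_mem _, Eventually.of_forall fun x => by simp⟩
  | succ n ih =>
    obtain ⟨κ, hκ, D, k₀, hD0, hDpos, hDmem, hcov⟩ := ih
    refine ⟨κ × ι, inferInstance, fun a => B.symm (D a.1) + d a.2, (k₀, i₀), ?_, ?_, ?_, ?_⟩
    · simp [hD0, hG.zero_digit]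
    · rintro ⟨k, i⟩ hne
      rw [map_add]
      by_cases hk : k = k₀
      · have hi : i ≠ i₀ := fun hi => hne (by rw [hk, hi])
        simpa [hk, hD0] using hK.pos hl (hG.digit_mem i) (hG.digit_ne_zero i hi)
      · have h1 : 0 < l (B.symm (D k)) := by
          refine (hpos _ (hB _ (hDmem k))).resolve_left fun h => ?_
          have h2 : D k = 0 := by simpa using h
          have := hDpos k hk
          rw [h2, map_zero] at this
          exact lt_irrefl _ this
        have h2 : 0 ≤ l (d i) := hK.nonneg (fun e he => (hl e he).le) (hG.digit_mem i)
        exact add_pos_of_pos_of_nonneg h1 h2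
    · rintro ⟨k, i⟩
      exact add_mem (hB _ (hDmem k)) (AddSubmonoid.subset_closure (hG.digit_mem i))
    · filter_upwards [ae_continuousLinearEquiv hcov B,
        ae_all_iff.2 fun k => ae_sub_right hG.cover (B.symm (D k))] with x h1 h2
      rw [Function.iterate_succ_apply, h1, Fintype.sum_prod_type]
      refine Finset.sum_congr rfl fun k _ => ?_
      have := h2 k
      rw [map_sub, B.apply_symm_apply] at this
      rw [this]
      refine Finset.sum_congr rfl fun i _ => ?_
      rw [sub_sub]

/-- For large `n` the map `B^[n]` sends the bounded slice `l < H` of `K` into the ball where `K` and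
`G` agree. -/
lemma exists_cover_cone (hG : IsConeTile μ K G B d i₀) (hK : IsConicPolyhedralSet K V)
    (hl : ∀ e ∈ V, 0 < l e) (H : ℝ) :
    ∃ (κ : Type) (_ : Fintype κ) (D : κ → E) (k₀ : κ), D k₀ = 0 ∧ (∀ k, k ≠ k₀ → 0 < l (D k)) ∧
      ∀ᵐ x ∂μ, l x < H →
        K.indicator (1 : E → ℝ) x = ∑ k, G.indicator (1 : E → ℝ) (x - D k) := by
  obtain ⟨c, hc, hcK⟩ := hK.exists_norm_le hl
  obtain ⟨r, hr, hrG⟩ := hG.exists_ball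
  obtain ⟨n, hn⟩ := hG.tendsto (c * H) r hr
  have hiter : ∀ (n : ℕ) x, B^[n] x ∈ K ↔ x ∈ K := fun n => by
    induction n with
    | zero => simp
    | succ n ih => intro x; rw [Function.iterate_succ_apply, ih, hG.map_mem]
  obtain ⟨κ, hκ, D, k₀, h1, h2, h3⟩ := hG.exists_cover_iterate hK hl n
  refine ⟨κ, hκ, D, k₀, h1, h2, ?_⟩
  filter_upwards [h3] with x hx hxH
  rw [← hx]
  by_cases hxK : x ∈ K
  · have hB : B^[n] x ∈ G := by
      refine (hrG _ (hn x ?_)).1 ((hiter n x).2 hxK)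
      exact (hcK x hxK).trans (by gcongr)
    simp [hxK, hB]
  · have hB : B^[n] x ∉ G := fun h => hxK ((hiter n x).1 (hG.subset h))
    simp [hxK, hB]

/-- Solve the covering relation for the unshifted `1_G`. Each remaining shift lowers `l` by at least
`δ`, so a formula valid below height `m * δ` extends to `(m + 1) * δ`; below height `0` the set `G`
is empty. -/
lemma exists_finsupp_of_lt (hG : IsConeTile μ K G B d i₀) (hK : IsConicPolyhedralSet K V)
    (hl : ∀ e ∈ V, 0 < l e) (H : ℝ) :
    ∃ r : E →₀ ℝ, ∀ᵐ x ∂μ, l x < H → G.indicator (1 : E → ℝ) x =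
      ∑ w ∈ r.support, r w * K.indicator (1 : E → ℝ) (x - w) := by
  classical
  obtain ⟨κ, _, D, k₀, hD0, hD, hcov⟩ := hG.exists_cover_cone hK hl H
  obtain ⟨δ, hδ, hδD⟩ : ∃ δ : ℝ, 0 < δ ∧ ∀ k, k ≠ k₀ → δ ≤ l (D k) := by
    have := Filter.eventually_all.2 fun k => (show ∀ᶠ δ : ℝ in 𝓝[>] 0, k ≠ k₀ → δ ≤ l (D k) by
      by_cases hk : k = k₀
      · exact Eventually.of_forall fun _ h => absurd hk h
      · filter_upwards [Ioc_mem_nhdsGT (hD k hk)] with δ hδ _ using hδ.2)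
    obtain ⟨δ, h1, h2⟩ := (this.and self_mem_nhdsWithin).exists
    exact ⟨δ, h2, h1⟩
  set S : Submodule ℝ (E → ℝ) :=
    Submodule.span ℝ (range fun w : E => fun x => K.indicator (1 : E → ℝ) (x - w)) with hS
  have hmem : ∀ w : E, (fun x => K.indicator (1 : E → ℝ) (x - w)) ∈ S :=
    fun w => Submodule.subset_span ⟨w, rfl⟩
  have htr : ∀ u : E, ∀ g ∈ S, (fun x => g (x - u)) ∈ S := by
    intro u
    have : S.map (LinearMap.funLeft ℝ ℝ fun x : E => x - u) ≤ S := by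
      rw [hS, Submodule.map_span_le]
      rintro _ ⟨w, rfl⟩
      convert! hmem (u + w) using 1
      ext x
      simp [LinearMap.funLeft_apply, sub_sub]
    exact fun g hg => this ⟨g, hg, rfl⟩
  have key : ∀ m : ℕ, ∃ g ∈ S, ∀ᵐ x ∂μ, l x < H → l x < m * δ →
      G.indicator (1 : E → ℝ) x = g x := by
    intro m
    induction m with
    | zero =>
      refine ⟨0, S.zero_mem, Eventually.of_forall fun x _ hx => ?_⟩
      have : x ∉ G := fun h => absurd
        (hK.nonneg (fun e he => (hl e he).le) (hG.subset h)) (not_le.2 (by simpa using hx))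
      simp [this]
    | succ m ih =>
      obtain ⟨g, hgS, hg⟩ := ih
      refine ⟨fun x => K.indicator (1 : E → ℝ) x -
        ∑ k ∈ Finset.univ.erase k₀, g (x - D k), ?_, ?_⟩
      · have h1 := S.sub_mem (hmem 0)
          (S.sum_mem fun k (_ : k ∈ Finset.univ.erase k₀) => htr (D k) g hgS)
        convert! h1 using 1
        ext x
        simp
      · filter_upwards [hcov, ae_all_iff.2 fun k => ae_sub_right hg (D k)] with x h1 h2 hxH hxm
        rw [h1 hxH, ← Finset.add_sum_erase _ _ (Finset.mem_univ k₀), hD0, sub_zero,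
          add_sub_assoc, ← Finset.sum_sub_distrib, Finset.sum_eq_zero, add_zero]
        intro k hk
        have hk' := hδD k (Finset.ne_of_mem_erase hk)
        rw [h2 k (by rw [map_sub]; linarith) (by
          rw [map_sub]; push_cast at hxm; linarith), sub_self]
  obtain ⟨m, hm⟩ := exists_nat_gt (H / δ)
  obtain ⟨g, hgS, hg⟩ := key m
  obtain ⟨r, hr⟩ := (Finsupp.mem_span_range_iff_exists_finsupp).1 hgS
  refine ⟨r, ?_⟩
  filter_upwards [hg] with x hx hxH
  rw [hx hxH (hxH.trans ((div_lt_iff₀ hδ).1 hm)), ← hr, Finsupp.sum, Finset.sum_apply]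
  rfl

/-- The indicator of a cone tile is a finite linear combination of indicators of translates of the
cone. -/
theorem exists_finsupp (hG : IsConeTile μ K G B d i₀) (hK : IsConicPolyhedralSet K V)
    (hl : ∀ e ∈ V, 0 < l e) :
    ∃ r : E →₀ ℝ, ∀ᵐ x ∂μ, G.indicator (1 : E → ℝ) x =
      ∑ w ∈ r.support, r w * K.indicator (1 : E → ℝ) (x - w) := by
  classical
  have step : ∀ H : ℝ, ∃ r : E →₀ ℝ, (∀ w ∈ r.support, w ∈ G) ∧ ∀ᵐ x ∂μ, l x < H →
      G.indicator (1 : E → ℝ) x = ∑ w ∈ r.support, r w * K.indicator (1 : E → ℝ) (x - w) := by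
    intro H
    obtain ⟨r, hr⟩ := hG.exists_finsupp_of_lt hK hl H
    -- Translates with apex at height at least `H` do not meet `l < H` and can be dropped.
    have hr' : ∀ᵐ x ∂μ, l x < H → G.indicator (1 : E → ℝ) x =
        ∑ w ∈ (r.filter fun w => l w < H).support,
          (r.filter fun w => l w < H) w * K.indicator (1 : E → ℝ) (x - w) := by
      filter_upwards [hr] with x hx hxH
      rw [hx hxH, Finsupp.support_filter, Finset.sum_filter]
      refine Finset.sum_congr rfl fun w _ => ?_
      split_ifs with hw
      · rw [Finsupp.filter_apply_pos (fun w => l w < H) r hw]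
      · have : x - w ∉ K := fun h => by
          have := hK.nonneg (fun e he => (hl e he).le) h
          rw [map_sub] at this
          linarith [not_lt.1 hw]
        simp [this]
    refine ⟨_, fun w hw => ?_, hr'⟩
    -- Near an apex outside `G` the combination is zero, so germ independence kills its coefficient.
    by_contra hwG
    have hwH : l w < H := by
      rw [Finsupp.support_filter, Finset.mem_filter] at hw
      exact hw.2
    have hev : ∀ᶠ x in 𝓝 w, l x < H ∧ x ∉ G :=
      (l.continuous.continuousAt.eventually (Iio_mem_nhds hwH)).and
        (hG.isCompact.isClosed.isOpen_compl.mem_nhds hwG)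
    obtain ⟨ρ, hρ, hb⟩ := Metric.eventually_nhds_iff_ball.1 hev
    refine Finsupp.mem_support_iff.1 hw
      (hK.coeff_eq_zero_of_ae_eq_zero (μ := μ) hl _ _ hρ ?_ hw)
    filter_upwards [hr'] with x hx hxb
    rw [← hx (hb x hxb).1, indicator_of_notMem (hb x hxb).2]
  choose r hrG hr using step
  obtain ⟨h₀, hh₀⟩ : ∃ h₀ : ℝ, ∀ x ∈ G, l x < h₀ := by
    obtain ⟨C, hC⟩ := hG.isCompact.bddAbove_image l.continuous.continuousOn
    exact ⟨C + 1, fun x hx => by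
      have := hC ⟨x, hx, rfl⟩
      linarith⟩
  -- All apexes lie in `G`, hence below `h₀`; both combinations equal `1_G` near each of them, so
  -- their coefficients agree.
  have huniq : ∀ n : ℕ, r h₀ = r (h₀ + n) := by
    intro n
    ext v
    by_cases hv : v ∈ (r h₀).support ∪ (r (h₀ + n)).support
    · have hvG : v ∈ G := by
        rcases Finset.mem_union.1 hv with h | h
        · exact hrG _ _ h
        · exact hrG _ _ h
      obtain ⟨ρ, hρ, hb⟩ := Metric.eventually_nhds_iff_ball.1
        (l.continuous.continuousAt.eventually (Iio_mem_nhds (hh₀ v hvG)))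
      refine sub_eq_zero.1 (hK.coeff_eq_zero_of_ae_eq_zero (μ := μ) hl _
        (fun w => r h₀ w - r (h₀ + n) w) hρ ?_ hv)
      filter_upwards [hr h₀, hr (h₀ + n)] with x h1 h2 hxb
      have hx1 : l x < h₀ := hb x hxb
      have hx2 : l x < h₀ + n := by
        have : (0 : ℝ) ≤ n := n.cast_nonneg
        linarith
      have e1 := h1 hx1
      rw [h2 hx2] at e1
      rw [Finset.sum_subset (Finset.subset_union_left (s₁ := (r h₀).support) (s₂ := (r (h₀ + n)).support))
        (fun w _ hw => by simp [Finsupp.notMem_support_iff.1 hw]),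
        Finset.sum_subset (Finset.subset_union_right (s₁ := (r h₀).support) (s₂ := (r (h₀ + n)).support))
        (fun w _ hw => by simp [Finsupp.notMem_support_iff.1 hw])] at e1
      simp only [sub_mul, Finset.sum_sub_distrib]
      rw [e1, sub_self]
    · rw [Finset.mem_union, not_or] at hv
      rw [Finsupp.notMem_support_iff.1 hv.1, Finsupp.notMem_support_iff.1 hv.2]
  refine ⟨r h₀, ?_⟩
  filter_upwards [ae_all_iff.2 fun n : ℕ => hr (h₀ + n)] with x hx
  obtain ⟨n, hn⟩ := exists_nat_gt (l x - h₀)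
  have := hx n (by linarith)
  rwa [← huniq n] at this

end IsConeTile

end Tilings

/-! ### Reading off a Taylor coefficient from a limit at zero. -/

section TaylorCoefficient

/-- With `t = ε⁻¹` the quotient becomes a polynomial in `t` with constant term `c n`; a finite limit
at infinity forces it to be constant. -/
lemma sum_coeff_eq_of_tendsto {n : ℕ} {c : ℕ → ℝ} {L : ℝ}
    (h : Tendsto (fun ε : ℝ => (∑ k ∈ Finset.range (n + 1), c k * ε ^ k) / ε ^ n) (𝓝[>] 0) (𝓝 L)) :
    c n = L := by
  set Q : Polynomial ℝ :=
    ∑ k ∈ Finset.range (n + 1), Polynomial.C (c k) * Polynomial.X ^ (n - k) with hQ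
  have hQt : Tendsto (fun t : ℝ => Q.eval t) atTop (𝓝 L) := by
    refine (h.comp tendsto_inv_atTop_nhdsGT_zero).congr' ?_
    filter_upwards [eventually_gt_atTop 0] with t ht
    simp only [Function.comp, hQ, Polynomial.eval_finsetSum, Finset.sum_div]
    refine Finset.sum_congr rfl fun k hk => ?_
    have hk' : k ≤ n := Nat.lt_succ_iff.1 (Finset.mem_range.1 hk)
    simp only [Polynomial.eval_mul, Polynomial.eval_C, Polynomial.eval_pow, Polynomial.eval_X]
    rw [pow_sub₀ t ht.ne' hk', inv_pow, inv_pow, div_inv_eq_mul]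
    ring
  obtain ⟨h1, h2⟩ := (Polynomial.tendsto_nhds_iff Q).1 hQt
  rw [Polynomial.eq_C_of_degree_le_zero h2, Polynomial.leadingCoeff_C] at h1
  rw [← h1, hQ, Polynomial.finsetSum_coeff, Finset.sum_range_succ, Finset.sum_eq_zero]
  · simp
  · intro k hk
    have : n - k ≠ 0 := by
      have := Finset.mem_range.1 hk
      omega
    simp [Polynomial.coeff_X_pow, this.symm]

/-- The exponentials may be replaced by their Taylor polynomials of degree `n`, the error being `o(ε
^ n)`. -/
lemma sum_pow_eq_of_tendsto {ι : Type*} (W : Finset ι) (r a : ι → ℝ) {n : ℕ} {L : ℝ}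
    (h : Tendsto (fun ε : ℝ => (∑ w ∈ W, r w * Real.exp (ε * a w)) / ε ^ n) (𝓝[>] 0) (𝓝 L)) :
    ∑ w ∈ W, r w * (a w ^ n / n.factorial) = L := by
  refine sum_coeff_eq_of_tendsto (c := fun k => ∑ w ∈ W, r w * (a w ^ k / k.factorial)) ?_
  have hrem : ∀ w ∈ W, (fun ε : ℝ => r w * (Real.exp (ε * a w) -
      ∑ k ∈ Finset.range (n + 1), (ε * a w) ^ k / k.factorial)) =o[𝓝[>] 0]
      fun ε : ℝ => ε ^ n := by
    intro w _
    have ht : Tendsto (fun ε : ℝ => ε * a w) (𝓝[>] 0) (𝓝 0) := by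
      have : ContinuousAt (fun ε : ℝ => ε * a w) 0 := by fun_prop
      simpa [ContinuousAt] using this.tendsto.mono_left nhdsWithin_le_nhds
    have h1 := (Real.exp_sub_sum_range_isBigO_pow (n + 1)).comp_tendsto ht
    have h2 : ((fun x : ℝ => x ^ (n + 1)) ∘ fun ε : ℝ => ε * a w) =O[𝓝[>] 0]
        fun ε : ℝ => ε ^ (n + 1) := by
      refine Asymptotics.IsBigO.of_bound (|a w| ^ (n + 1)) (Eventually.of_forall fun ε => ?_)
      simp only [Function.comp, mul_pow, norm_mul, norm_pow, Real.norm_eq_abs]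
      rw [mul_comm]
    have h3 : (fun ε : ℝ => ε ^ (n + 1)) =o[𝓝[>] 0] fun ε : ℝ => ε ^ n :=
      (Asymptotics.isLittleO_pow_pow (Nat.lt_succ_self n)).mono nhdsWithin_le_nhds
    exact ((h1.trans h2).trans_isLittleO h3).const_mul_left (r w)
  have hsum := (Asymptotics.IsLittleO.sum hrem).tendsto_div_nhds_zero
  have := h.sub hsum
  rw [sub_zero] at this
  refine this.congr fun ε => ?_
  rw [← sub_div]
  congr 1
  rw [Finset.sum_apply, ← Finset.sum_sub_distrib]
  simp only [mul_sub, sub_sub_cancel]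
  simp only [Finset.mul_sum, Finset.sum_mul]
  rw [Finset.sum_comm]
  refine Finset.sum_congr rfl fun k _ => Finset.sum_congr rfl fun w _ => ?_
  rw [mul_pow]
  ring

end TaylorCoefficient

/-! ### The Laplace transform of a cone and its reciprocal form. -/

section Laplace

variable {E : Type*} [NormedAddCommGroup E] [NormedSpace ℝ E] [FiniteDimensional ℝ E]
  [MeasurableSpace E] [BorelSpace E] (μ : Measure E) [μ.IsAddHaarMeasure]

/-- The Laplace transform of the indicator of a set. -/
noncomputable def laplace (S : Set E) (s : E →L[ℝ] ℝ) : ℝ := ∫ x in S, Real.exp (-s x) ∂μ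

variable {μ}

/-- On `S` the exponential is dominated by a multiple of `(1 + ‖x‖) ^ (-n)`, integrable because `n`
exceeds the dimension by one. -/
lemma integrableOn_exp_neg {S : Set E} (hS : MeasurableSet S) {s : E →L[ℝ] ℝ} {c : ℝ} (hc : 0 < c)
    (h : ∀ x ∈ S, ‖x‖ ≤ c * s x) : IntegrableOn (fun x => Real.exp (-s x)) S μ := by
  set n := Module.finrank ℝ E + 1 with hn
  have hn0 : (0 : ℝ) < n := by positivity
  have hint : Integrable (fun x : E => (1 + c * n) ^ n * (1 + ‖x‖) ^ (-(n : ℝ))) μ :=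
    (integrable_one_add_norm (by rw [hn]; push_cast; linarith)).const_mul _
  refine Integrable.mono' hint.integrableOn (by fun_prop) ?_
  filter_upwards [ae_restrict_mem hS] with x hx
  have hx' := h x hx
  have ht : 0 ≤ s x := by
    by_contra hneg
    nlinarith [norm_nonneg x, not_le.1 hneg]
  rw [Real.norm_of_nonneg (Real.exp_pos _).le, Real.rpow_neg (by positivity), Real.rpow_natCast,
    Real.exp_neg, ← div_eq_mul_inv, inv_eq_one_div,
    div_le_div_iff₀ (Real.exp_pos _) (by positivity), one_mul]
  have h1 : 1 + ‖x‖ ≤ (1 + c * n) * Real.exp (s x / n) := by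
    have h2 := Real.add_one_le_exp (s x / n)
    calc 1 + ‖x‖ ≤ 1 + c * s x := by linarith
      _ ≤ (1 + c * n) * (s x / n + 1) := by
        have : (1 + c * n) * (s x / n + 1) = 1 + c * s x + (s x / n + c * n) := by
          field_simp
          ring
        rw [this]
        have : 0 ≤ s x / n + c * n := by positivity
        linarith
      _ ≤ _ := by gcongr
  calc (1 + ‖x‖) ^ n ≤ ((1 + c * n) * Real.exp (s x / n)) ^ n := by gcongr
    _ = (1 + c * n) ^ n * Real.exp (s x) := by
      rw [mul_pow, ← Real.exp_nat_mul, mul_div_cancel₀ _ hn0.ne']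

namespace IsConicPolyhedralSet

variable {K : Set E} {V : Finset E} (hK : IsConicPolyhedralSet K V) {s : E →L[ℝ] ℝ}
include hK

lemma integrableOn_exp (hs : ∀ e ∈ V, 0 < s e) : IntegrableOn (fun x => Real.exp (-s x)) K μ := by
  obtain ⟨c, hc, h⟩ := hK.exists_norm_le hs
  exact integrableOn_exp_neg hK.isClosed.measurableSet hc h

lemma laplace_pos (hs : ∀ e ∈ V, 0 < s e) : 0 < laplace μ K s := by
  obtain ⟨U, hUo, hUn, hUK, -⟩ := hK.exists_isOpen_subset one_pos
  have hpos : 0 < μ K := (hUo.measure_pos μ hUn).trans_le (measure_mono hUK)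
  refine (setIntegral_pos_iff_support_of_nonneg_ae ?_ (hK.integrableOn_exp hs)).2 ?_
  · exact Eventually.of_forall fun x => (Real.exp_pos _).le
  · have : Function.support (fun x => Real.exp (-s x)) = univ := by
      ext x; simp [(Real.exp_pos _).ne']
    rwa [this, univ_inter]

open scoped Pointwise in
lemma laplace_smul {ε : ℝ} (hε : 0 < ε) :
    laplace μ K (ε • s) = (ε ^ Module.finrank ℝ E)⁻¹ * laplace μ K s := by
  have hset : ε • K = K := by
    ext x
    rw [Set.mem_smul_set_iff_inv_smul_mem₀ hε.ne', hK.smul_mem_iff (inv_pos.2 hε)]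
  have := Measure.setIntegral_comp_smul_of_pos μ (fun x => Real.exp (-s x)) K hε
  rw [hset, smul_eq_mul] at this
  rw [laplace, laplace, ← this]
  simp

lemma laplace_eq_sum {G : Set E} (hG : MeasurableSet G) (r : E →₀ ℝ)
    (hr : ∀ᵐ x ∂μ, G.indicator (1 : E → ℝ) x =
      ∑ w ∈ r.support, r w * K.indicator (1 : E → ℝ) (x - w)) (hs : ∀ e ∈ V, 0 < s e) :
    laplace μ G s = (∑ w ∈ r.support, r w * Real.exp (-s w)) * laplace μ K s := by
  have hi : Integrable (K.indicator fun x => Real.exp (-s x)) μ :=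
    (integrable_indicator_iff hK.isClosed.measurableSet).2 (hK.integrableOn_exp hs)
  have h1 : ∀ᵐ x ∂μ, G.indicator (fun x => Real.exp (-s x)) x = ∑ w ∈ r.support,
      (r w * Real.exp (-s w)) * K.indicator (fun x => Real.exp (-s x)) (x - w) := by
    filter_upwards [hr] with x hx
    have e1 : ∀ (S : Set E) y, S.indicator (fun x => Real.exp (-s x)) y =
        S.indicator (1 : E → ℝ) y * Real.exp (-s y) := fun S y => by
      by_cases h : y ∈ S <;> simp [h]
    rw [e1, hx, Finset.sum_mul]
    refine Finset.sum_congr rfl fun w _ => ?_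
    rw [e1]
    have : Real.exp (-s x) = Real.exp (-s w) * Real.exp (-s (x - w)) := by
      rw [← Real.exp_add, map_sub]; congr 1; ring
    rw [this]
    ring
  rw [laplace, ← integral_indicator hG, integral_congr_ae h1, integral_finsetSum]
  · rw [Finset.sum_mul]
    refine Finset.sum_congr rfl fun w _ => ?_
    rw [integral_const_mul, integral_sub_right_eq_self (K.indicator fun x => Real.exp (-s x)),
      integral_indicator hK.isClosed.measurableSet, laplace]
  · intro w _
    exact (hi.comp_sub_right w).const_mul _

end IsConicPolyhedralSet

omit [FiniteDimensional ℝ E] in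
lemma tendsto_laplace_smul {G : Set E} (hG : IsCompact G) (s : E →L[ℝ] ℝ) :
    Tendsto (fun ε : ℝ => laplace μ G (ε • s)) (𝓝[>] 0) (𝓝 (μ.real G)) := by
  obtain ⟨C, hC⟩ := hG.exists_bound_of_continuousOn s.continuous.continuousOn
  have h0 : μ.real G = ∫ x in G, (1 : ℝ) ∂μ := by simp
  rw [h0]
  refine tendsto_integral_filter_of_dominated_convergence (fun _ => Real.exp |C|) ?_ ?_ ?_ ?_
  · exact Eventually.of_forall fun ε => by fun_prop
  · filter_upwards [Ioc_mem_nhdsGT (zero_lt_one' ℝ)] with ε hε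
    filter_upwards [ae_restrict_mem hG.measurableSet] with x hx
    rw [Real.norm_of_nonneg (Real.exp_pos _).le, Real.exp_le_exp]
    have h1 : |s x| ≤ |C| := (hC x hx).trans (le_abs_self C)
    calc -((ε • s) x) ≤ |(ε • s) x| := neg_le_abs _
      _ = ε * |s x| := by simp [abs_mul, abs_of_pos hε.1]
      _ ≤ 1 * |C| := mul_le_mul hε.2 h1 (abs_nonneg _) zero_le_one
      _ = |C| := one_mul _
  · have : IsFiniteMeasure (μ.restrict G) := ⟨by simpa using hG.measure_lt_top⟩
    exact integrable_const _
  · refine Eventually.of_forall fun x => ?_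
    have : ContinuousAt (fun ε : ℝ => Real.exp (-(ε • s) x)) 0 := by
      simp only [smul_apply]
      fun_prop
    simpa [ContinuousAt] using this.tendsto.mono_left nhdsWithin_le_nhds

/-- The homogeneous polynomial on the dual space that is reciprocal to the Laplace transform of
a cone whose finite signed combination of translates is the indicator of a bounded set. -/
noncomputable def momentForm (r : E →₀ ℝ) (s : E →L[ℝ] ℝ) : ℝ :=
  ∑ w ∈ r.support, r w * ((-s w) ^ Module.finrank ℝ E / (Module.finrank ℝ E).factorial)

/-- At `ε • s` the transform of `G` is `∑ r w * exp (-ε s w) / ε ^ n` times that of `K` at `s`, with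
`n` the dimension, and it tends to `vol G`. The limit of the quotient is the Taylor coefficient
`momentForm r s`. -/
theorem IsConicPolyhedralSet.momentForm_mul_laplace {K G : Set E} {V : Finset E}
    (hK : IsConicPolyhedralSet K V) (hG : IsCompact G) (r : E →₀ ℝ)
    (hr : ∀ᵐ x ∂μ, G.indicator (1 : E → ℝ) x =
      ∑ w ∈ r.support, r w * K.indicator (1 : E → ℝ) (x - w)) {s : E →L[ℝ] ℝ}
    (hs : ∀ e ∈ V, 0 < s e) : momentForm r s * laplace μ K s = μ.real G := by
  have hpos : 0 < laplace μ K s := hK.laplace_pos hs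
  rw [← eq_div_iff hpos.ne']
  refine sum_pow_eq_of_tendsto r.support (fun w => r w) (fun w => -s w) ?_
  refine ((tendsto_laplace_smul hG s).div_const (laplace μ K s)).congr' ?_
  filter_upwards [self_mem_nhdsWithin] with ε hε
  have hε' : (0 : ℝ) < ε := hε
  rw [hK.laplace_eq_sum hG.measurableSet r hr (s := ε • s)
    (fun e he => by simpa using mul_pos hε' (hs e he)), hK.laplace_smul hε']
  have : ∀ w : E, -(ε • s) w = ε * (-s w) := fun w => by simp
  simp only [this]
  field_simp

end Laplace

/-! ### Forms vanishing on coordinate hyperplanes. -/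

section Polynomials

/-- A form of degree equal to the number of variables that vanishes on all coordinate hyperplanes
is a multiple of the product of the variables. -/
lemma MvPolynomial.eval_eq_mul_prod_of_vanish {σ : Type*} [Fintype σ] (P : MvPolynomial σ ℝ)
    (hP : P.IsHomogeneous (Fintype.card σ))
    (h : ∀ (j : σ) (z : σ → ℝ), z j = 0 → MvPolynomial.eval z P = 0) :
    ∃ κ : ℝ, ∀ z : σ → ℝ, MvPolynomial.eval z P = κ * ∏ j, z j := by
  classical
  have h0 : ∀ (j : σ), ∀ m ∈ P.support, m j ≠ 0 := by
    intro j m hm hmj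
    -- `R` collects the monomials free of the variable `j`, which are what remains of `P` on `z j =
    -- 0`.
    set R : MvPolynomial σ ℝ := ∑ m ∈ P.support.filter (fun m => m j = 0),
      MvPolynomial.monomial m (P.coeff m) with hR
    have hR0 : R = 0 := by
      refine MvPolynomial.funext fun z => ?_
      rw [map_zero, ← h j (Function.update z j 0) (by simp), MvPolynomial.eval_eq' _ P, hR, map_sum,
        Finset.sum_filter]
      refine Finset.sum_congr rfl fun m _ => ?_
      split_ifs with hm0
      · rw [MvPolynomial.eval_monomial, Finsupp.prod_fintype _ _ (fun i => pow_zero _)]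
        congr 1
        refine Finset.prod_congr rfl fun i _ => ?_
        by_cases hi : i = j
        · rw [hi, hm0, pow_zero, pow_zero]
        · rw [Function.update_of_ne hi]
      · rw [Finset.prod_eq_zero (Finset.mem_univ j), mul_zero]
        simp [hm0]
    have : R.coeff m = P.coeff m := by
      rw [hR, MvPolynomial.coeff_sum]
      simp only [MvPolynomial.coeff_monomial]
      rw [Finset.sum_ite_eq', if_pos (Finset.mem_filter.2 ⟨hm, hmj⟩)]
    rw [hR0, MvPolynomial.coeff_zero] at this
    exact MvPolynomial.mem_support_iff.1 hm this.symm
  have h1 : ∀ m ∈ P.support, ∀ j, m j = 1 := by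
    intro m hm
    have hdeg : ∑ j, m j = ∑ _j : σ, 1 := by
      have := hP (MvPolynomial.mem_support_iff.1 hm)
      rw [Finsupp.weight_apply, Finsupp.sum_fintype _ _ (by simp)] at this
      simpa using this
    -- Every exponent is at least one and they add up to the number of variables.
    have := (Finset.sum_eq_sum_iff_of_le fun j _ => Nat.one_le_iff_ne_zero.2 (h0 j m hm)).1
      hdeg.symm
    exact fun j => (this j (Finset.mem_univ j)).symm
  refine ⟨∑ m ∈ P.support, P.coeff m, fun z => ?_⟩
  rw [MvPolynomial.eval_eq', Finset.sum_mul]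
  refine Finset.sum_congr rfl fun m hm => ?_
  simp [h1 m hm]

end Polynomials

/-! ### The dual cone is simple. -/

section DualCone

variable {E : Type*} [NormedAddCommGroup E] [NormedSpace ℝ E] [FiniteDimensional ℝ E]

omit [FiniteDimensional ℝ E] in
lemma momentForm_line_eq_zero (r : E →₀ ℝ) (s q : E →L[ℝ] ℝ)
    (h : ∀ᶠ t : ℝ in 𝓝[>] 0, momentForm r (s + t • q) = 0) (t : ℝ) :
    momentForm r (s + t • q) = 0 := by
  set n := Module.finrank ℝ E with hn
  set Q : Polynomial ℝ := ∑ w ∈ r.support, Polynomial.C (r w / n.factorial) *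
    (Polynomial.C (-s w) + Polynomial.C (-q w) * Polynomial.X) ^ n with hQ
  have hev : ∀ t : ℝ, Q.eval t = momentForm r (s + t • q) := by
    intro t
    rw [momentForm, hQ, Polynomial.eval_finsetSum]
    refine Finset.sum_congr rfl fun w _ => ?_
    simp only [Polynomial.eval_mul, Polynomial.eval_C, Polynomial.eval_pow, Polynomial.eval_add,
      Polynomial.eval_X, add_apply, smul_apply, smul_eq_mul]
    rw [← hn, div_mul_eq_mul_div, mul_div_assoc]
    congr 3
    ring
  have hQ0 : Q = 0 := by
    refine Polynomial.eq_zero_of_infinite_isRoot Q ?_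
    obtain ⟨ε, hε, hsub⟩ := (mem_nhdsGT_iff_exists_Ioo_subset).1 h
    refine (Ioo_infinite hε).mono fun t ht => ?_
    have := hsub ht
    change Q.eval t = 0
    rw [hev]
    exact this
  rw [← hev, hQ0, Polynomial.eval_zero]

omit [FiniteDimensional ℝ E] in
lemma map_eq_sum_repr {σ : Type*} [Fintype σ] (b : Module.Basis σ ℝ E) (s : E →L[ℝ] ℝ) (w : E) :
    s w = ∑ j, b.repr w j * s (b j) := by
  calc s w = s (∑ j, b.repr w j • b j) := by rw [b.sum_repr]
    _ = _ := by rw [map_sum]; simp only [map_smul, smul_eq_mul]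

lemma momentForm_eq_mul_prod {σ : Type*} [Fintype σ] (b : Module.Basis σ ℝ E) (r : E →₀ ℝ)
    (h : ∀ (j : σ) (s : E →L[ℝ] ℝ), s (b j) = 0 → momentForm r s = 0) :
    ∃ κ : ℝ, ∀ s : E →L[ℝ] ℝ, momentForm r s = κ * ∏ j, s (b j) := by
  set n := Module.finrank ℝ E with hn
  have hcard : Fintype.card σ = n := (Module.finrank_eq_card_basis b).symm
  set P : MvPolynomial σ ℝ := ∑ w ∈ r.support, MvPolynomial.C (r w / n.factorial) *
    (∑ j, MvPolynomial.C (-(b.repr w j)) * MvPolynomial.X j) ^ n with hP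
  have hev : ∀ s : E →L[ℝ] ℝ, MvPolynomial.eval (fun j => s (b j)) P = momentForm r s := by
    intro s
    rw [momentForm, hP, map_sum]
    refine Finset.sum_congr rfl fun w _ => ?_
    simp only [map_mul, map_pow, map_sum, MvPolynomial.eval_C, MvPolynomial.eval_X]
    rw [← hn, map_eq_sum_repr b s w, div_mul_eq_mul_div, mul_div_assoc]
    simp
  obtain ⟨κ, hκ⟩ := MvPolynomial.eval_eq_mul_prod_of_vanish P (by
    rw [hcard]
    refine MvPolynomial.IsHomogeneous.sum _ _ _ fun w _ => ?_
    have h1 : (∑ j, MvPolynomial.C (-(b.repr w j)) * MvPolynomial.X j :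
        MvPolynomial σ ℝ).IsHomogeneous 1 :=
      MvPolynomial.IsHomogeneous.sum _ _ _ fun j _ => by
        simpa using (MvPolynomial.isHomogeneous_C σ (-(b.repr w j))).mul
          (MvPolynomial.isHomogeneous_X ℝ j)
    simpa using (MvPolynomial.isHomogeneous_C σ (r w / (n.factorial : ℝ))).mul (h1.pow n))
    (fun j z hz => by
      set s : E →L[ℝ] ℝ := LinearMap.toContinuousLinearMap (b.constr ℝ z) with hs
      have hsz : (fun j => s (b j)) = z := by
        ext j; simp [hs, b.constr_basis]
      rw [← hsz, hev]
      exact h j s (by rw [← hz, ← hsz]))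
  exact ⟨κ, fun s => by rw [← hev, hκ]⟩

variable [MeasurableSpace E] [BorelSpace E] {μ : Measure E} [μ.IsAddHaarMeasure]

namespace IsConicPolyhedralSet

variable {K : Set E} {V : Finset E}

-- Take a convex piece `C` containing `e`. Since `s e = 0`, the integrals over `C` and `C + e ⊆ C`
-- agree; were they finite, `C \ (C + e)` would be null, yet it contains the part of `C` below
-- height `l e`.
omit [FiniteDimensional ℝ E] in
lemma lintegral_exp_eq_top (hK : IsConicPolyhedralSet K V) {l : E →L[ℝ] ℝ}
    (hl : ∀ e ∈ V, 0 < l e) {s : E →L[ℝ] ℝ} {e : E} (he : e ∈ V) (hse : s e = 0) :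
    ∫⁻ x in K, ENNReal.ofReal (Real.exp (-s x)) ∂μ = ⊤ := by
  by_contra hfin
  obtain ⟨C, hCK, heC, hCm, hCsmul, hCadd, hCi⟩ := hK.exists_piece e (hK.gen_mem e he)
  set h : E → ENNReal := fun x => ENNReal.ofReal (Real.exp (-s x)) with hh
  have hmeas : Measurable h := by fun_prop
  set C' : Set E := (fun x => x - e) ⁻¹' C with hC'
  have hC'm : MeasurableSet C' := hCm.preimage (measurable_sub_const e)
  have hC'C : C' ⊆ C := fun x hx => by simpa using hCadd _ hx _ heC
  have hCfin : ∫⁻ x in C, h x ∂μ ≠ ⊤ := ne_top_of_le_ne_top hfin (lintegral_mono_set hCK)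
  have heq : ∫⁻ x in C', h x ∂μ = ∫⁻ x in C, h x ∂μ := by
    rw [← lintegral_indicator hC'm, ← lintegral_indicator hCm,
      ← lintegral_sub_right_eq_self (C.indicator h) e]
    refine lintegral_congr fun x => ?_
    by_cases hx : x - e ∈ C
    · rw [indicator_of_mem hx, indicator_of_mem (show x ∈ C' from hx)]
      simp [hh, hse]
    · rw [indicator_of_notMem hx, indicator_of_notMem (show x ∉ C' from hx)]
  have hdiff : ∫⁻ x in C \ C', h x ∂μ = 0 := by
    have := lintegral_inter_add_sdiff h C hC'm (μ := μ)
    rw [inter_eq_right.2 hC'C, heq] at this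
    exact (ENNReal.add_right_inj hCfin).1 (by rw [this, add_zero])
  have hnull : μ (C \ C') = 0 := by
    rw [lintegral_eq_zero_iff hmeas] at hdiff
    have h1 : ∀ᵐ x ∂(μ.restrict (C \ C')), False := by
      filter_upwards [hdiff] with x hx
      simp only [hh, Pi.zero_apply, ENNReal.ofReal_eq_zero] at hx
      exact absurd hx (not_le.2 (Real.exp_pos _))
    simpa using h1
  obtain ⟨δ, hδ, hb⟩ := Metric.eventually_nhds_iff_ball.1
    (l.continuous.continuousAt.eventually (Iio_mem_nhds (show l 0 < l e by simpa using hl e he)))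
  obtain ⟨U, hUo, hUn, hUC, hUb⟩ := exists_isOpen_subset_of_cone hCsmul hCi hδ
  have hsub : U ⊆ C \ C' := fun x hx => ⟨hUC hx, fun hxC' => by
    have h1 := hK.nonneg (fun e he => (hl e he).le) (hCK hxC')
    have h2 : l x < l e := hb x (hUb hx)
    rw [map_sub] at h1
    linarith⟩
  exact (hUo.measure_pos μ hUn).ne' (measure_mono_null hsub hnull)

/-- Approach `s` from inside the dual cone along `l`. If the form were nonzero at `s`, the
transforms would stay bounded, and Fatou's lemma would contradict the divergence at `s`. -/
lemma momentForm_eq_zero (hK : IsConicPolyhedralSet K V) {l : E →L[ℝ] ℝ}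
    (hl : ∀ e ∈ V, 0 < l e) {r : E →₀ ℝ} {c : ℝ}
    (hr : ∀ s : E →L[ℝ] ℝ, (∀ e ∈ V, 0 < s e) → momentForm r s * laplace μ K s = c)
    {s : E →L[ℝ] ℝ} (hs : ∀ e ∈ V, 0 ≤ s e) {e : E} (he : e ∈ V) (hse : s e = 0) :
    momentForm r s = 0 := by
  by_contra hne
  set S : ℕ → E →L[ℝ] ℝ := fun n => s + ((n : ℝ) + 1)⁻¹ • l with hS
  have hSpos : ∀ n, ∀ e ∈ V, 0 < S n e := fun n e he => by
    have h1 : 0 < ((n : ℝ) + 1)⁻¹ * l e := mul_pos (by positivity) (hl e he)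
    simpa [hS] using add_pos_of_nonneg_of_pos (hs e he) h1
  have hlim : ∀ x, Tendsto (fun n => S n x) atTop (𝓝 (s x)) := by
    intro x
    have := (tendsto_one_div_add_atTop_nhds_zero_nat (𝕜 := ℝ)).mul_const (l x)
    have := this.const_add (s x)
    simpa [hS] using this
  have hmf : Tendsto (fun n => momentForm r (S n)) atTop (𝓝 (momentForm r s)) := by
    refine tendsto_finsetSum _ fun w _ => ?_
    exact ((((hlim w).neg).pow _).div_const _).const_mul _
  have hlap : Tendsto (fun n => laplace μ K (S n)) atTop (𝓝 (c / momentForm r s)) := by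
    refine (tendsto_const_nhds.div hmf hne).congr fun n => ?_
    have h1 := hr (S n) (hSpos n)
    have h2 := hr l hl
    rcases eq_or_ne (momentForm r (S n)) 0 with h0 | h0
    -- One zero of the form inside the dual cone gives `c = 0`, so the form vanishes at every `S k`
    -- and in the limit.
    · have hl0 : momentForm r l = 0 := by
        rw [h0, zero_mul] at h1
        rw [← h1] at h2
        exact (mul_eq_zero.1 h2).resolve_right (hK.laplace_pos hl).ne'
      exfalso
      refine hne (tendsto_nhds_unique hmf (tendsto_const_nhds.congr fun k => ?_))
      have h3 := hr (S k) (hSpos k)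
      rw [← h2, hl0, zero_mul] at h3
      exact ((mul_eq_zero.1 h3).resolve_right (hK.laplace_pos (hSpos k)).ne').symm
    · rw [Pi.div_apply, div_eq_iff h0, mul_comm, h1]
  have hfatou : ∫⁻ x in K, ENNReal.ofReal (Real.exp (-s x)) ∂μ ≤
      liminf (fun n => ∫⁻ x in K, ENNReal.ofReal (Real.exp (-S n x)) ∂μ) atTop := by
    have h1 : ∀ x, ENNReal.ofReal (Real.exp (-s x)) =
        liminf (fun n => ENNReal.ofReal (Real.exp (-S n x))) atTop := fun x =>
      ((ENNReal.tendsto_ofReal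
        ((Real.continuous_exp.tendsto _).comp (hlim x).neg)).liminf_eq).symm
    simp only [h1]
    exact lintegral_liminf_le fun n => by fun_prop
  have hval : ∀ n, ∫⁻ x in K, ENNReal.ofReal (Real.exp (-S n x)) ∂μ =
      ENNReal.ofReal (laplace μ K (S n)) := fun n =>
    (ofReal_integral_eq_lintegral_ofReal (hK.integrableOn_exp (hSpos n))
      (Eventually.of_forall fun x => (Real.exp_pos _).le)).symm
  simp only [hval, (ENNReal.tendsto_ofReal hlap).liminf_eq] at hfatou
  rw [hK.lintegral_exp_eq_top hl he hse] at hfatou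
  exact absurd hfatou (by simp)

/-- If the Laplace transform of a polyhedral cone is the reciprocal of a form of degree equal to
the dimension, then the cone lies in the cone generated by a basis, and its Laplace transform is
a multiple of the one of that simple cone. -/
theorem exists_basis (hK : IsConicPolyhedralSet K V) {l : E →L[ℝ] ℝ}
    (hl : ∀ e ∈ V, 0 < l e) {r : E →₀ ℝ} {c : ℝ} (hc : 0 < c)
    (hr : ∀ s : E →L[ℝ] ℝ, (∀ e ∈ V, 0 < s e) → momentForm r s * laplace μ K s = c) :
    ∃ (b : Module.Basis (Fin (Module.finrank ℝ E)) ℝ E) (κ : ℝ), 0 < κ ∧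
      (∀ x ∈ K, ∀ j, 0 ≤ b.repr x j) ∧
      ∀ s : E →L[ℝ] ℝ, (∀ j, 0 < s (b j)) → laplace μ K s * ∏ j, s (b j) = κ := by
  classical
  -- `I` is a smallest set of constraints cutting out the dual cone; its members correspond to
  -- facets.
  obtain ⟨I, hI, hImin⟩ := Finset.exists_min_image (V.powerset.filter fun I =>
    ∀ s : E →L[ℝ] ℝ, (∀ e ∈ I, 0 ≤ s e) → ∀ e ∈ V, 0 ≤ s e) Finset.card
    ⟨V, by simp⟩
  rw [Finset.mem_filter, Finset.mem_powerset] at hI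
  obtain ⟨hIV, hIdual⟩ := hI
  -- By minimality some functional is negative at `i` and nonnegative on the rest of `I`; adding a
  -- multiple of `l` moves it to the relative interior of the facet.
  have hfacet : ∀ i ∈ I, ∃ s : E →L[ℝ] ℝ, s i = 0 ∧ ∀ j ∈ I, j ≠ i → 0 < s j := by
    intro i hi
    have hnot : ¬ ∀ s : E →L[ℝ] ℝ, (∀ e ∈ I.erase i, 0 ≤ s e) → ∀ e ∈ V, 0 ≤ s e := fun h => by
      have := hImin (I.erase i) (Finset.mem_filter.2
        ⟨Finset.mem_powerset.2 ((Finset.erase_subset i I).trans hIV), h⟩)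
      exact absurd this (not_le.2 (Finset.card_erase_lt_of_mem hi))
    push Not at hnot
    obtain ⟨s, hs, e, heV, hse⟩ := hnot
    have hsi : s i < 0 := by
      by_contra hge
      refine absurd (hIdual s (fun j hj => ?_) e heV) (not_le.2 hse)
      by_cases hji : j = i
      · rw [hji]; exact not_lt.1 hge
      · exact hs j (Finset.mem_erase.2 ⟨hji, hj⟩)
    have hli := hl i (hIV hi)
    refine ⟨s + (-s i / l i) • l, ?_, fun j hj hji => ?_⟩
    · simp [div_mul_cancel₀ _ hli.ne']
    · have h1 := hs j (Finset.mem_erase.2 ⟨hji, hj⟩)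
      have h2 : 0 < -s i / l i * l j := mul_pos (div_pos (by linarith) hli) (hl j (hIV hj))
      simpa using add_pos_of_nonneg_of_pos h1 h2
  -- Starting from such an `s`, a short step towards any `q` with `q i = 0` stays on the facet, so
  -- the form vanishes along the whole line.
  have hvanish : ∀ i ∈ I, ∀ q : E →L[ℝ] ℝ, q i = 0 → momentForm r q = 0 := by
    intro i hi q hq
    obtain ⟨s, hsi, hs⟩ := hfacet i hi
    have := momentForm_line_eq_zero r s (q - s) ?_ 1
    · simpa using this
    have h1 : ∀ᶠ t : ℝ in 𝓝[>] 0, ∀ j ∈ I, j ≠ i → 0 < (s + t • (q - s)) j := by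
      refine (Filter.eventually_all_finset I).2 fun j hj => ?_
      by_cases hji : j = i
      · exact Eventually.of_forall fun _ h => absurd hji h
      · have hcont : ContinuousAt (fun t : ℝ => (s + t • (q - s)) j) 0 := by
          simp only [add_apply, smul_apply]
          fun_prop
        filter_upwards [(hcont.eventually (Ioi_mem_nhds
          (show 0 < (s + (0 : ℝ) • (q - s)) j by simpa using hs j hj hji))).filter_mono
          nhdsWithin_le_nhds] with t ht _ using ht
    filter_upwards [h1] with t ht
    have h0 : (s + t • (q - s)) i = 0 := by simp [hsi, hq]
    refine hK.momentForm_eq_zero hl hr (hIdual _ fun j hj => ?_) (hIV hi) h0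
    by_cases hji : j = i
    · rw [hji, h0]
    · exact (ht j hj hji).le
  -- A functional killing `I` would vanish on `K`, which has interior points.
  have hspan : Submodule.span ℝ (I : Set E) = ⊤ := by
    by_contra hne
    obtain ⟨f, hf0, hf⟩ := Submodule.exists_le_ker_of_lt_top _ (lt_top_iff_ne_top.2 hne)
    set s : E →L[ℝ] ℝ := LinearMap.toContinuousLinearMap f with hs
    have hsI : ∀ e ∈ I, s e = 0 := fun e he => hf (Submodule.subset_span he)
    have hsK : ∀ x ∈ K, s x = 0 := fun x hx => by
      have h1 := hK.nonneg (hIdual s fun e he => (hsI e he).ge) hx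
      have h2 := hK.nonneg (s := -s) (hIdual (-s) fun e he => by simp [hsI e he]) hx
      simp only [neg_apply] at h2
      linarith
    obtain ⟨U, hUo, ⟨x, hx⟩, hUK, -⟩ := hK.exists_isOpen_subset one_pos
    refine hf0 (LinearMap.ext fun y => ?_)
    have hcont : ContinuousAt (fun t : ℝ => x + t • y) 0 := by fun_prop
    have hev : ∀ᶠ t : ℝ in 𝓝[>] 0, x + t • y ∈ U :=
      (hcont.eventually (hUo.mem_nhds (by simpa using hx))).filter_mono nhdsWithin_le_nhds
    obtain ⟨t, ht, ht0⟩ := (hev.and self_mem_nhdsWithin).exists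
    have h1 := hsK _ (hUK ht)
    rw [map_add, hsK x (hUK hx), zero_add, map_smul, smul_eq_mul] at h1
    exact (mul_eq_zero.1 h1).resolve_left (ne_of_gt ht0)
  obtain ⟨B, hBI, hBspan, hBli⟩ := exists_linearIndependent ℝ (I : Set E)
  have hBfin : B.Finite := I.finite_toSet.subset hBI
  have : Fintype B := hBfin.fintype
  set b₀ : Module.Basis B ℝ E := Module.Basis.mk hBli (by
    rw [Subtype.range_coe, hBspan, hspan]) with hb₀
  have hcard : Fintype.card B = Module.finrank ℝ E := (Module.finrank_eq_card_basis b₀).symm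
  set b := b₀.reindex (Fintype.equivFinOfCardEq hcard) with hb
  have hbB : ∀ j, b j ∈ B := fun j => by
    rw [hb, Module.Basis.reindex_apply, hb₀, Module.Basis.mk_apply]
    exact Subtype.coe_prop _
  have hBb : ∀ e ∈ B, ∃ j, b j = e := fun e he => by
    refine ⟨Fintype.equivFinOfCardEq hcard ⟨e, he⟩, ?_⟩
    rw [hb, Module.Basis.reindex_apply, hb₀, Module.Basis.mk_apply, Equiv.symm_apply_apply]
  obtain ⟨κ, hκ⟩ := momentForm_eq_mul_prod b r fun j s hs => hvanish (b j) (hBI (hbB j)) s hs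
  have hκ0 : κ ≠ 0 := fun h => by
    have := hr l hl
    rw [hκ l, h, zero_mul, zero_mul] at this
    exact hc.ne this
  -- For an extra `i`, the facet functional is positive on the whole basis, so the product, and with
  -- it the form, could not vanish there.
  have hIB : ∀ i ∈ I, i ∈ B := by
    intro i hi
    by_contra hiB
    obtain ⟨s, hsi, hs⟩ := hfacet i hi
    have h1 := hvanish i hi s hsi
    rw [hκ s] at h1
    refine (mul_ne_zero hκ0 (Finset.prod_ne_zero_iff.2 fun j _ => ?_)) h1
    exact (hs (b j) (hBI (hbB j)) fun h => hiB (h ▸ hbB j)).ne'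
  have hKb : ∀ x ∈ K, ∀ j, 0 ≤ b.repr x j := by
    intro x hx j
    refine hK.nonneg (s := LinearMap.toContinuousLinearMap (b.coord j)) (hIdual _ ?_) hx
    intro e he
    obtain ⟨k, rfl⟩ := hBb e (hIB e he)
    simp only [LinearMap.coe_toContinuousLinearMap', Module.Basis.coord_apply,
      Module.Basis.repr_self, Finsupp.single_apply]
    split_ifs <;> norm_num
  have hpos : ∀ s : E →L[ℝ] ℝ, (∀ j, 0 < s (b j)) → ∀ e ∈ V, 0 < s e := by
    intro s hs e he
    have hnn : ∀ j ∈ Finset.univ, 0 ≤ b.repr e j * s (b j) :=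
      fun j _ => mul_nonneg (hKb e (hK.gen_mem e he) j) (hs j).le
    rw [map_eq_sum_repr b s e]
    refine (Finset.sum_nonneg hnn).lt_of_ne fun h0 => hK.gen_ne_zero e he ?_
    have h1 := (Finset.sum_eq_zero_iff_of_nonneg hnn).1 h0.symm
    refine b.repr.map_eq_zero_iff.1 (Finsupp.ext fun j => ?_)
    exact (mul_eq_zero.1 (h1 j (Finset.mem_univ j))).resolve_right (hs j).ne'
  have hval : ∀ s : E →L[ℝ] ℝ, (∀ j, 0 < s (b j)) → laplace μ K s * ∏ j, s (b j) = c / κ := by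
    intro s hs
    have := hr s (hpos s hs)
    rw [hκ s] at this
    rw [eq_div_iff hκ0, ← this]
    ring
  refine ⟨b, c / κ, ?_, hKb, hval⟩
  set u : E →L[ℝ] ℝ := LinearMap.toContinuousLinearMap (b.constr ℝ fun _ => (1 : ℝ)) with hu
  have hub : ∀ j, u (b j) = 1 := fun j => by simp [hu, b.constr_basis]
  have hu1 : ∀ j, 0 < u (b j) := fun j => by rw [hub]; exact one_pos
  rw [← hval u hu1]
  exact mul_pos (hK.laplace_pos (hpos u hu1)) (Finset.prod_pos fun j _ => hu1 j)

end IsConicPolyhedralSet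

end DualCone

/-! ### Simple cones and uniqueness of the Laplace transform. -/

section Uniqueness

variable {E : Type*} [NormedAddCommGroup E] [NormedSpace ℝ E] [FiniteDimensional ℝ E]

/-- The cone of nonnegative combinations of the vectors of a basis. -/
def basisCone {σ : Type*} (b : Module.Basis σ ℝ E) : Set E := {x | ∀ j, 0 ≤ b.repr x j}

variable {σ : Type*} [Fintype σ] (b : Module.Basis σ ℝ E)

omit [Fintype σ] in
lemma continuous_repr (j : σ) : Continuous fun x => b.repr x j :=
  (b.coord j).continuous_of_finiteDimensional

omit [Fintype σ] in
lemma isClosed_basisCone : IsClosed (basisCone b) := by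
  have : basisCone b = ⋂ j, (fun x => b.repr x j) ⁻¹' Ici 0 := by
    ext x; simp [basisCone]
  rw [this]
  exact isClosed_iInter fun j => isClosed_Ici.preimage (continuous_repr b j)

lemma isOpen_forall_repr_pos : IsOpen {x : E | ∀ j, 0 < b.repr x j} := by
  have : {x : E | ∀ j, 0 < b.repr x j} = ⋂ j, (fun x => b.repr x j) ⁻¹' Ioi 0 := by
    ext x; simp
  rw [this]
  exact isOpen_iInter_of_finite fun j => isOpen_Ioi.preimage (continuous_repr b j)

omit [FiniteDimensional ℝ E] in
lemma map_nonneg_of_mem_basisCone {s : E →L[ℝ] ℝ} (hs : ∀ j, 0 ≤ s (b j)) {x : E}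
    (hx : x ∈ basisCone b) : 0 ≤ s x := by
  rw [map_eq_sum_repr b s x]
  exact Finset.sum_nonneg fun j _ => mul_nonneg (hx j) (hs j)

variable [MeasurableSpace E] [BorelSpace E] {μ : Measure E} [μ.IsAddHaarMeasure]

lemma integrableOn_exp_basisCone {s : E →L[ℝ] ℝ} (hs : ∀ j, 0 < s (b j)) :
    IntegrableOn (fun x => Real.exp (-s x)) (basisCone b) μ := by
  have h0 : 0 ≤ ∑ j, ‖b j‖ / s (b j) :=
    Finset.sum_nonneg fun j _ => div_nonneg (norm_nonneg _) (hs j).le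
  refine integrableOn_exp_neg (isClosed_basisCone b).measurableSet
    (c := ∑ j, ‖b j‖ / s (b j) + 1) (by linarith) fun x hx => ?_
  have h1 := norm_sum_smul_le (I := Finset.univ) (v := b) (fun j _ => hs j) hx
  rw [b.sum_repr] at h1
  have h2 := map_nonneg_of_mem_basisCone b (fun j => (hs j).le) hx
  linarith

/-- The functional taking the value one at all basis vectors. -/
noncomputable def sumCoords : E →L[ℝ] ℝ :=
  LinearMap.toContinuousLinearMap (b.constr ℝ fun _ => (1 : ℝ))

omit [MeasurableSpace E] [BorelSpace E] [Fintype σ] in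
lemma sumCoords_apply (j : σ) : sumCoords b (b j) = 1 := by simp [sumCoords, b.constr_basis]

lemma laplace_basisCone_pos {s : E →L[ℝ] ℝ} (hs : ∀ j, 0 < s (b j)) :
    0 < laplace μ (basisCone b) s := by
  have hsub : {x : E | ∀ j, 0 < b.repr x j} ⊆ basisCone b := fun x hx j => (hx j).le
  have hpos : 0 < μ (basisCone b) :=
    ((isOpen_forall_repr_pos b).measure_pos μ ⟨∑ j, b j, fun j => by
      classical
      simp [map_sum, Finsupp.single_apply]⟩).trans_le (measure_mono hsub)
  refine (setIntegral_pos_iff_support_of_nonneg_ae ?_ (integrableOn_exp_basisCone b hs)).2 ?_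
  · exact Eventually.of_forall fun x => (Real.exp_pos _).le
  · have : Function.support (fun x => Real.exp (-s x)) = univ := by
      ext x; simp [(Real.exp_pos _).ne']
    rwa [this, univ_inter]

/-- The diagonal map `b j ↦ (s (b j))⁻¹ • b j` preserves the cone, turns `s` into `sumCoords b`, and
has the inverse product as determinant. -/
lemma laplace_basisCone_mul_prod {s : E →L[ℝ] ℝ} (hs : ∀ j, 0 < s (b j)) :
    laplace μ (basisCone b) s * ∏ j, s (b j) = laplace μ (basisCone b) (sumCoords b) := by
  classical
  set S : E →ₗ[ℝ] E := Matrix.toLin b b (Matrix.diagonal fun j => (s (b j))⁻¹) with hS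
  have hSb : ∀ j, S (b j) = (s (b j))⁻¹ • b j := fun j => by
    rw [hS, Matrix.toLin_self]
    simp [Matrix.diagonal_apply]
  have hdet : LinearMap.det S = (∏ j, s (b j))⁻¹ := by
    rw [hS, LinearMap.det_toLin, Matrix.det_diagonal, Finset.prod_inv_distrib]
  have hprod : 0 < ∏ j, s (b j) := Finset.prod_pos fun j _ => hs j
  have hdet0 : LinearMap.det S ≠ 0 := by rw [hdet]; exact (inv_pos.2 hprod).ne'
  have hSmeas : Measurable S := S.continuous_of_finiteDimensional.measurable
  have hrepr : ∀ x j, b.repr (S x) j = (s (b j))⁻¹ * b.repr x j := by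
    intro x j
    conv_lhs => rw [← b.sum_repr x]
    simp only [map_sum, map_smul, hSb, Finsupp.coe_finsetSum, Finset.sum_apply, Finsupp.smul_apply,
      Module.Basis.repr_self, smul_eq_mul, Finsupp.single_apply]
    rw [Finset.sum_eq_single j]
    · simp [mul_comm]
    · intro i _ hij
      simp [hij]
    · simp
  have hmem : ∀ x, S x ∈ basisCone b ↔ x ∈ basisCone b := fun x => by
    refine forall_congr' fun j => ?_
    rw [hrepr]
    exact mul_nonneg_iff_of_pos_left (inv_pos.2 (hs j))
  have hsS : ∀ x, s (S x) = sumCoords b x := fun x => by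
    rw [map_eq_sum_repr b s, map_eq_sum_repr b (sumCoords b) x]
    refine Finset.sum_congr rfl fun j _ => ?_
    rw [hrepr, sumCoords_apply, mul_one, mul_comm, ← mul_assoc, mul_inv_cancel₀ (hs j).ne', one_mul]
  have hm := (isClosed_basisCone b).measurableSet
  have h1 : ∫ x, (basisCone b).indicator (fun x => Real.exp (-s x)) (S x) ∂μ =
      laplace μ (basisCone b) (sumCoords b) := by
    rw [laplace, ← integral_indicator hm]
    refine integral_congr_ae (Eventually.of_forall fun x => ?_)
    by_cases hx : x ∈ basisCone b
    · simp [hx, (hmem x).2 hx, hsS]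
    · simp [hx, mt (hmem x).1 hx]
  rw [← h1, ← integral_map hSmeas.aemeasurable
    ((by fun_prop : Measurable fun x => Real.exp (-s x)).indicator hm).aestronglyMeasurable,
    Measure.map_linearMap_addHaar_eq_smul_addHaar μ hdet0, integral_smul_measure,
    integral_indicator hm, hdet, inv_inv, abs_of_pos hprod, ENNReal.toReal_ofReal hprod.le,
    smul_eq_mul, mul_comm, laplace]

open BoundedContinuousFunction in
/-- A finite measure on a simple cone is determined by its Laplace transform. -/
theorem ext_of_integral_exp_eq {P P' : Measure (basisCone b)} [IsFiniteMeasure P]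
    [IsFiniteMeasure P']
    (h : ∀ s : E →L[ℝ] ℝ, (∀ j, 0 ≤ s (b j)) →
      ∫ x, Real.exp (-s (x : E)) ∂P = ∫ x, Real.exp (-s (x : E)) ∂P') : P = P' := by
  have hpol : PolishSpace (basisCone b) := by
    have := (isClosed_basisCone b)
    exact this.polishSpace
  let e : {s : E →L[ℝ] ℝ // ∀ j, 0 ≤ s (b j)} → (basisCone b →ᵇ ℝ) := fun s =>
    BoundedContinuousFunction.ofNormedAddCommGroup (fun x => Real.exp (-s.1 (x : E)))
      (by fun_prop) 1 (fun x => by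
        rw [Real.norm_of_nonneg (Real.exp_pos _).le, Real.exp_le_one_iff, neg_nonpos]
        exact map_nonneg_of_mem_basisCone b s.2 x.2)
  -- The exponentials are closed under products, so the algebra they generate is their linear span;
  -- the coordinate functionals make it separate points.
  let Sm : Submonoid (basisCone b →ᵇ ℝ) :=
    { carrier := range e
      one_mem' := ⟨⟨0, fun j => le_rfl⟩, by
        ext x
        simp [e]⟩
      mul_mem' := by
        rintro _ _ ⟨s, rfl⟩ ⟨t, rfl⟩
        refine ⟨⟨s.1 + t.1, fun j => add_nonneg (s.2 j) (t.2 j)⟩, ?_⟩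
        ext x
        simp [e, ← Real.exp_add, add_comm] }
  let A : StarSubalgebra ℝ (basisCone b →ᵇ ℝ) :=
    { Algebra.adjoin ℝ (Sm : Set (basisCone b →ᵇ ℝ)) with
      star_mem' := fun {f} hf => by
        have : star f = f := by ext x; simp
        rw [this]
        exact hf }
  have hA : ∀ g ∈ A, g ∈ Submodule.span ℝ (range e) := by
    intro g hg
    have hg' : g ∈ Subalgebra.toSubmodule
      (Algebra.adjoin ℝ (Sm : Set (basisCone b →ᵇ ℝ))) := hg
    rw [Algebra.adjoin_eq_span, Submonoid.closure_eq] at hg'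
    exact hg'
  refine ext_of_forall_mem_subalgebra_integral_eq_of_polish (𝕜 := ℝ) (A := A) ?_ ?_
  · intro x y hxy
    obtain ⟨j, hj⟩ : ∃ j, b.repr (x : E) j ≠ b.repr (y : E) j := by
      by_contra hcon
      push Not at hcon
      exact hxy (Subtype.ext (b.repr.injective (Finsupp.ext hcon)))
    have hcoord : ∀ i, 0 ≤ LinearMap.toContinuousLinearMap (b.coord j) (b i) := fun i => by
      classical
      simp only [LinearMap.coe_toContinuousLinearMap', Module.Basis.coord_apply,
        Module.Basis.repr_self, Finsupp.single_apply]
      split_ifs <;> norm_num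
    refine ⟨_, ⟨toContinuousMapStarₐ ℝ (e ⟨_, hcoord⟩), ⟨e ⟨_, hcoord⟩, ?_, rfl⟩, rfl⟩, ?_⟩
    · exact Algebra.subset_adjoin ⟨_, rfl⟩
    · change Real.exp _ ≠ Real.exp _
      intro hexp
      exact hj (by simpa using hexp)
  · intro g hg
    have hg' := hA g hg
    clear hg
    induction hg' using Submodule.span_induction with
    | mem g hg =>
      obtain ⟨s, rfl⟩ := hg
      exact h s.1 s.2
    | zero => simp
    | add f g _ _ h1 h2 =>
      have e1 : ∀ (Q : Measure (basisCone b)) [IsFiniteMeasure Q],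
          ∫ x, (f + g) x ∂Q = ∫ x, f x ∂Q + ∫ x, g x ∂Q := fun Q _ => by
        simp only [BoundedContinuousFunction.coe_add, Pi.add_apply]
        exact integral_add (f.integrable Q) (g.integrable Q)
      rw [e1, e1, h1, h2]
    | smul a f _ h1 =>
      simp only [BoundedContinuousFunction.coe_smul, integral_smul]
      rw [h1]

/-- A closed subset of a simple cone whose Laplace transform is a nonzero multiple of that of the
cone is the whole cone. -/
theorem basisCone_subset_of_laplace {K : Set E} (hK : IsClosed K) (hsub : K ⊆ basisCone b) {κ : ℝ}
    (hκ : 0 < κ)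
    (h : ∀ s : E →L[ℝ] ℝ, (∀ j, 0 < s (b j)) → laplace μ K s * ∏ j, s (b j) = κ) :
    basisCone b ⊆ K := by
  -- The weight `exp (-u)` makes the measures finite and replaces `s` by `s + u`, which is strictly
  -- positive on the basis even when `s` is only nonnegative.
  set u := sumCoords b with hu
  have hu0 : ∀ j, 0 < u (b j) := fun j => by rw [hu, sumCoords_apply]; exact one_pos
  set c := laplace μ (basisCone b) u with hc
  have hc0 : 0 < c := laplace_basisCone_pos b hu0
  have hm := (isClosed_basisCone b).measurableSet
  have hprop : ∀ s : E →L[ℝ] ℝ, (∀ j, 0 < s (b j)) →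
      c * laplace μ K s = κ * laplace μ (basisCone b) s := fun s hs => by
    have hp : (∏ j, s (b j)) ≠ 0 := (Finset.prod_pos fun j _ => hs j).ne'
    have h1 := h s hs
    have h2 := laplace_basisCone_mul_prod (μ := μ) b hs
    rw [hc, hu, ← h2, ← h1]
    ring
  have hint := integrableOn_exp_basisCone (μ := μ) b hu0
  set lam : Measure (basisCone b) := μ.comap Subtype.val with hlam
  set f : E → ℝ := K.indicator fun x => c * Real.exp (-u x) with hf
  set g : E → ℝ := fun x => κ * Real.exp (-u x) with hg
  have hf0 : ∀ x, 0 ≤ f x := fun x =>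
    indicator_nonneg (fun x _ => mul_nonneg hc0.le (Real.exp_pos _).le) x
  have hg0 : ∀ x, 0 < g x := fun x => mul_pos hκ (Real.exp_pos _)
  have hfm : Measurable f :=
    (by fun_prop : Measurable fun x => c * Real.exp (-u x)).indicator hK.measurableSet
  have hgm : Measurable g := by fun_prop
  have hemb : MeasurableEmbedding (Subtype.val : basisCone b → E) := MeasurableEmbedding.subtype_coe hm
  have hmap : lam.map Subtype.val = μ.restrict (basisCone b) := by
    rw [hlam, hemb.map_comap, Subtype.range_coe]
  have hfi : Integrable (fun x : basisCone b => f x) lam := by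
    have : Integrable f (lam.map Subtype.val) := by
      rw [hmap]
      exact (hint.const_mul c).indicator hK.measurableSet
    exact hemb.integrable_map_iff.1 this
  have hgi : Integrable (fun x : basisCone b => g x) lam := by
    have : Integrable g (lam.map Subtype.val) := by
      rw [hmap]
      exact hint.const_mul κ
    exact hemb.integrable_map_iff.1 this
  set P := lam.withDensity fun x => ENNReal.ofReal (f x) with hP
  set P' := lam.withDensity fun x => ENNReal.ofReal (g x) with hP'
  have : IsFiniteMeasure P := isFiniteMeasure_withDensity_ofReal hfi.2
  have : IsFiniteMeasure P' := isFiniteMeasure_withDensity_ofReal hgi.2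
  have hPP : P = P' := by
    refine ext_of_integral_exp_eq b fun s hs => ?_
    have hsu : ∀ j, 0 < (s + u) (b j) := fun j => by
      simpa using add_pos_of_nonneg_of_pos (hs j) (hu0 j)
    rw [hP, hP', integral_withDensity_eq_integral_toReal_smul (by fun_prop)
      (Eventually.of_forall fun _ => ENNReal.ofReal_lt_top),
      integral_withDensity_eq_integral_toReal_smul (by fun_prop)
      (Eventually.of_forall fun _ => ENNReal.ofReal_lt_top)]
    have e1 : ∀ x, (ENNReal.ofReal (f x)).toReal • Real.exp (-s x) =
        K.indicator (fun x => c * Real.exp (-(s + u) x)) x := fun x => by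
      rw [ENNReal.toReal_ofReal (hf0 x), hf]
      by_cases hx : x ∈ K
      · simp only [indicator_of_mem hx, smul_eq_mul, add_apply, neg_add, Real.exp_add]
        ring
      · simp [hx]
    have e2 : ∀ x, (ENNReal.ofReal (g x)).toReal • Real.exp (-s x) =
        κ * Real.exp (-(s + u) x) := fun x => by
      rw [ENNReal.toReal_ofReal (hg0 x).le, hg]
      simp only [smul_eq_mul, add_apply, neg_add, Real.exp_add]
      ring
    simp only [e1, e2]
    rw [hlam, integral_subtype_comap hm (K.indicator fun x => c * Real.exp (-(s + u) x)),
      integral_subtype_comap hm (fun x => κ * Real.exp (-(s + u) x)),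
      setIntegral_indicator hK.measurableSet, inter_eq_right.2 hsub, integral_const_mul,
      integral_const_mul]
    exact hprop _ hsu
  -- `P` does not charge the complement of `K`, while the density of `P'` is positive everywhere.
  have hnull : μ (basisCone b \ K) = 0 := by
    have hSm : MeasurableSet {x : basisCone b | (x : E) ∉ K} :=
      hK.measurableSet.compl.preimage measurable_subtype_coe
    have h0 : P {x : basisCone b | (x : E) ∉ K} = 0 := by
      rw [hP, withDensity_apply _ hSm, setLIntegral_congr_fun (g := fun _ => 0) hSm
        (fun x (hx : (x : E) ∉ K) => by simp [hf, hx])]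
      simp
    rw [hPP] at h0
    have h1 : lam {x : basisCone b | (x : E) ∉ K} = 0 :=
      withDensity_absolutelyContinuous' (by fun_prop)
        (Eventually.of_forall fun x => by simpa using hg0 x) h0
    rw [hlam, hemb.comap_apply] at h1
    convert! h1 using 2
    ext x
    simp [and_comm]
  have hopen : {x : E | ∀ j, 0 < b.repr x j} ⊆ K := by
    by_contra hne
    obtain ⟨x, hx, hxK⟩ := not_subset.1 hne
    have hO := (isOpen_forall_repr_pos b).inter hK.isOpen_compl
    refine (hO.measure_pos μ ⟨x, hx, hxK⟩).ne' (measure_mono_null ?_ hnull)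
    exact fun y hy => ⟨fun j => (hy.1 j).le, hy.2⟩
  intro x hx
  have ht : Tendsto (fun t : ℝ => x + t • ∑ j, b j) (𝓝[>] 0) (𝓝 x) := by
    have : ContinuousAt (fun t : ℝ => x + t • ∑ j, b j) 0 := by fun_prop
    simpa [ContinuousAt] using this.tendsto.mono_left nhdsWithin_le_nhds
  refine hK.mem_of_tendsto ht ?_
  filter_upwards [self_mem_nhdsWithin] with t ht
  refine hopen fun j => ?_
  have h1 : b.repr (∑ j, b j) j = 1 := by
    classical
    simp [map_sum, Finsupp.single_apply]
  rw [map_add, map_smul, Finsupp.add_apply, Finsupp.smul_apply, h1, smul_eq_mul, mul_one]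
  exact add_pos_of_nonneg_of_pos (hx j) ht

end Uniqueness

/-! ### The inverse of an expanding map contracts. -/

section Contraction

attribute [local instance] Matrix.linftyOpNormedRing Matrix.linftyOpNormedAlgebra

/-- By Gelfand's formula the norm of `A ^ k` is eventually below `q ^ k` for some `q < 1`. -/
lemma tendsto_pow_of_spectrum {n : Type*} [Fintype n] [DecidableEq n] [Nonempty n]
    (A : Matrix n n ℂ) (hA : ∀ z ∈ spectrum ℂ A, ‖z‖ < 1) :
    ∀ i j, Tendsto (fun k : ℕ => (A ^ k) i j) atTop (𝓝 0) := by
  intro i j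
  have hlt : spectralRadius ℂ A < (1 : NNReal) :=
    spectrum.spectralRadius_lt_of_forall_lt A fun z hz => by
      have := hA z hz
      exact_mod_cast this
  obtain ⟨q, hq1, hq2⟩ := ENNReal.lt_iff_exists_nnreal_btwn.1 hlt
  have hgel := spectrum.pow_nnnorm_pow_one_div_tendsto_nhds_spectralRadius A
  have hq2' : q < 1 := by exact_mod_cast hq2
  rw [tendsto_zero_iff_norm_tendsto_zero]
  refine squeeze_zero' (Eventually.of_forall fun _ => norm_nonneg _) ?_
    (tendsto_pow_atTop_nhds_zero_of_lt_one q.2 hq2')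
  filter_upwards [hgel.eventually (gt_mem_nhds hq1), eventually_gt_atTop 0] with k hk hk0
  have hk0' : (0 : ℝ) < k := by exact_mod_cast hk0
  have hle : ‖(A ^ k) i j‖₊ ≤ ‖A ^ k‖₊ := by
    rw [Matrix.linfty_opNNNorm_def]
    exact (Finset.single_le_sum (f := fun j => ‖(A ^ k) i j‖₊) (fun _ _ => zero_le)
      (Finset.mem_univ j)).trans
      (Finset.le_sup (f := fun i => ∑ j, ‖(A ^ k) i j‖₊) (Finset.mem_univ i))
  have h1 := ENNReal.rpow_lt_rpow hk hk0'
  rw [← ENNReal.rpow_mul, one_div_mul_cancel hk0'.ne', ENNReal.rpow_one, ENNReal.rpow_natCast,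
    ← ENNReal.coe_pow, ENNReal.coe_lt_coe] at h1
  exact_mod_cast hle.trans h1.le

lemma IsExpanding.det_ne_zero {d : ℕ}
    {M : EuclideanSpace ℝ (Fin d) →ₗ[ℝ] EuclideanSpace ℝ (Fin d)} (hM : IsExpanding M) :
    LinearMap.det M ≠ 0 := by
  intro h
  have h0 : M.charpoly.coeff 0 = 0 := by
    have := LinearMap.det_eq_sign_charpoly_coeff M
    rw [h] at this
    simpa using this.symm
  have := hM 0 (by
    rw [Polynomial.IsRoot, ← Polynomial.coeff_zero_eq_eval_zero, Polynomial.coeff_map, h0, map_zero])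
  norm_num at this

/-- The complex eigenvalues of `B` are the reciprocals of those of `M`, so the entries of its powers
tend to zero. -/
lemma IsExpanding.exists_iterate_lt {d : ℕ}
    {M : EuclideanSpace ℝ (Fin d) →ₗ[ℝ] EuclideanSpace ℝ (Fin d)} (hM : IsExpanding M)
    (B : EuclideanSpace ℝ (Fin d) →ₗ[ℝ] EuclideanSpace ℝ (Fin d)) (hMB : ∀ x, M (B x) = x)
    (R ε : ℝ) (hε : 0 < ε) : ∃ n : ℕ, ∀ x, ‖x‖ ≤ R → ‖B^[n] x‖ < ε := by
  rcases isEmpty_or_nonempty (Fin d) with hd | hd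
  · exact ⟨0, fun x _ => by rwa [Subsingleton.elim (B^[0] x) 0, norm_zero]⟩
  set b := (EuclideanSpace.basisFun (Fin d) ℝ).toBasis with hb
  set m := LinearMap.toMatrix b b M with hm
  set p := LinearMap.toMatrix b b B with hp
  set φ : Matrix (Fin d) (Fin d) ℝ →+* Matrix (Fin d) (Fin d) ℂ :=
    (algebraMap ℝ ℂ).mapMatrix with hφ
  have hmp : m * p = 1 := by
    rw [hm, hp, ← LinearMap.toMatrix_comp, ← LinearMap.toMatrix_id b]
    congr 1
    exact LinearMap.ext hMB
  have hpm : p * m = 1 := mul_eq_one_comm.1 hmp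
  have hspec : ∀ z ∈ spectrum ℂ (φ p), ‖z‖ < 1 := by
    intro z hz
    let U : (Matrix (Fin d) (Fin d) ℂ)ˣ := ⟨φ p, φ m, by rw [← map_mul, hpm, map_one],
      by rw [← map_mul, hmp, map_one]⟩
    have hz' : z⁻¹ ∈ spectrum ℂ (φ m) := by
      have h1 := spectrum.map_inv (𝕜 := ℂ) U
      change (spectrum ℂ (φ p))⁻¹ = spectrum ℂ (φ m) at h1
      rw [← h1, Set.mem_inv, inv_inv]
      exact hz
    rw [Matrix.mem_spectrum_iff_isRoot_charpoly] at hz'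
    have h2 : (φ m).charpoly = M.charpoly.map (algebraMap ℝ ℂ) := by
      rw [← LinearMap.charpoly_toMatrix M b]
      exact Matrix.charpoly_map m (algebraMap ℝ ℂ)
    rw [h2] at hz'
    have h3 := hM _ hz'
    rw [norm_inv] at h3
    exact (one_lt_inv_iff₀.1 h3).2
  have hlim := tendsto_pow_of_spectrum (φ p) hspec
  have hent : ∀ i j, Tendsto (fun n : ℕ => (p ^ n) i j) atTop (𝓝 0) := by
    intro i j
    have h3 := (Complex.continuous_re.tendsto _).comp (hlim i j)
    refine (h3.congr fun n => ?_)
    rw [Function.comp, ← map_pow, hφ]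
    simp
  have hvec : ∀ j, Tendsto (fun n : ℕ => (B ^ n) (b j)) atTop (𝓝 0) := by
    intro j
    have h1 : ∀ n : ℕ, (B ^ n) (b j) = ∑ i, (p ^ n) i j • b i := fun n => by
      have h2 : p ^ n = LinearMap.toMatrix b b (B ^ n) := LinearMap.toMatrix_pow ..
      rw [h2]
      conv_lhs => rw [← b.sum_repr ((B ^ n) (b j))]
      simp only [LinearMap.toMatrix_apply]
    simp only [h1]
    have := tendsto_finsetSum Finset.univ fun i _ => (hent i j).smul_const (b i)
    simpa using this
  have hsum : Tendsto (fun n : ℕ => |R| * ∑ j, ‖(B ^ n) (b j)‖) atTop (𝓝 0) := by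
    have := (tendsto_finsetSum Finset.univ fun j _ => (hvec j).norm).const_mul |R|
    simpa using this
  obtain ⟨n, hn⟩ := (hsum.eventually (gt_mem_nhds hε)).exists
  refine ⟨n, fun x hx => ?_⟩
  refine lt_of_le_of_lt ?_ hn
  have hx' : x = ∑ j, x j • b j := by
    conv_lhs => rw [← b.sum_repr x]
    simp [hb]
  rw [← Module.End.pow_apply, Finset.mul_sum]
  conv_lhs => rw [hx']
  rw [map_sum]
  refine (norm_sum_le _ _).trans (Finset.sum_le_sum fun j _ => ?_)
  rw [map_smul, norm_smul]
  gcongr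
  exact (PiLp.norm_apply_le x j).trans (hx.trans (le_abs_self R))

end Contraction

/-! ### Assembly. -/

section Main

/-- A pointed polyhedral cone that contains a tile agreeing with it near the apex is simple. -/
theorem IsConeTile.exists_eq_basisCone {E : Type*} [NormedAddCommGroup E] [NormedSpace ℝ E]
    [FiniteDimensional ℝ E] [MeasurableSpace E] [BorelSpace E] {μ : Measure E}
    [μ.IsAddHaarMeasure] {K G : Set E} {V : Finset E} {B : E ≃L[ℝ] E} {ι : Type} [Fintype ι]
    {d : ι → E} {i₀ : ι} {l : E →L[ℝ] ℝ} (hG : IsConeTile μ K G B d i₀)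
    (hK : IsConicPolyhedralSet K V) (hl : ∀ e ∈ V, 0 < l e) (hpos : μ G ≠ 0) :
    ∃ b : Module.Basis (Fin (Module.finrank ℝ E)) ℝ E, K = basisCone b := by
  obtain ⟨r, hr⟩ := hG.exists_finsupp hK hl
  have hc : 0 < μ.real G := ENNReal.toReal_pos hpos hG.isCompact.measure_lt_top.ne
  obtain ⟨b, κ, hκ, hsub, hlap⟩ := hK.exists_basis hl hc
    fun s hs => hK.momentForm_mul_laplace hG.isCompact r hr hs
  exact ⟨b, Subset.antisymm hsub (basisCone_subset_of_laplace b hK.isClosed hsub hκ hlap)⟩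

lemma zero_mem_extremePoints_preimage_add {E : Type*} [AddCommGroup E] [Module ℝ E] {G : Set E}
    {v : E} (hv : v ∈ (convexHull ℝ G).extremePoints ℝ) :
    (0 : E) ∈ (convexHull ℝ ((fun y => v + y) ⁻¹' G)).extremePoints ℝ := by
  have hmap : ∀ y ∈ convexHull ℝ ((fun y => v + y) ⁻¹' G), v + y ∈ convexHull ℝ G := by
    refine fun y hy => convexHull_min (s := (fun y => v + y) ⁻¹' G)
      (t := (fun y => v + y) ⁻¹' convexHull ℝ G) ?_ ?_ hy
    · exact preimage_mono (subset_convexHull ℝ G)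
    · exact (convex_convexHull ℝ G).translate_preimage_right v
  have hvG : v ∈ G := extremePoints_convexHull_subset hv
  refine ⟨subset_convexHull ℝ _ (by simpa using hvG), fun x hx y hy hxy => ?_⟩
  have h := (mem_openSegment_translate ℝ v).2 hxy
  rw [add_zero] at h
  have h1 := hv.2 (hmap x hx) (hmap y hy) h
  simpa using h1

lemma sum_indicator_eq_one_of_existsUnique {E : Type*} [AddCommGroup E] {ι : Type*} [Fintype ι]
    {G : Set E} {d : ι → E} {x : E} (hne : ∃ j, x - d j ∈ G)
    (huniq : ∀ i j, i ≠ j → ¬(x - d i ∈ G ∧ x - d j ∈ G)) :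
    ∑ j, G.indicator (1 : E → ℝ) (x - d j) = 1 := by
  obtain ⟨j, hj⟩ := hne
  rw [Finset.sum_eq_single j, indicator_of_mem hj, Pi.one_apply]
  · intro i _ hij
    exact indicator_of_notMem (fun hi => huniq i j hij ⟨hi, hj⟩) _
  · exact fun h => absurd (Finset.mem_univ j) h

/-- Centred at `v`, the map `A i` is `M`, so the tile at `v` is `M⁻¹ G₀` and the others are its
shifts by `a j`. Applying `M` gives the digits `M (a j)`. -/
theorem exists_isConeTile {d N : ℕ} {G : Set (EuclideanSpace ℝ (Fin d))}
    {T : Fin N → Set (EuclideanSpace ℝ (Fin d))}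
    {A : Fin N → (EuclideanSpace ℝ (Fin d) →ᵃ[ℝ] EuclideanSpace ℝ (Fin d))}
    (hGc : IsCompact G) (hT : IsSelfAffineTiling G T A) {v : EuclideanSpace ℝ (Fin d)}
    (hv : IsStationaryVertex G T A v) (hlc : LocallyConic ((fun y => v + y) ⁻¹' G) 0) :
    ∃ (B : EuclideanSpace ℝ (Fin d) ≃L[ℝ] EuclideanSpace ℝ (Fin d))
      (D : Fin N → EuclideanSpace ℝ (Fin d)) (i₀ : Fin N),
      IsConeTile volume (germCone ((fun y => v + y) ⁻¹' G)) ((fun y => v + y) ⁻¹' G) B D i₀ := by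
  classical
  obtain ⟨hvext, i, -, hfix, hcone, -, hsub⟩ := hv
  obtain ⟨M, hM, hlin⟩ := hT.dilation
  have hvG : v ∈ G := extremePoints_convexHull_subset hvext
  set G₀ := (fun y => v + y) ⁻¹' G with hG₀
  set K := germCone G₀ with hK
  have hcorner : ∀ x, x ∈ cornerCone G v ↔ x - v ∈ K := fun x => Iff.rfl
  set e := (M.equivOfDetNeZero hM.det_ne_zero).toContinuousLinearEquiv with he
  have heM : ∀ x, e x = M x := fun x => rfl
  have hA : ∀ x, A i x = v + M (x - v) := fun x => by
    have := (A i).linearMap_vsub x v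
    rw [hlin, hfix, vsub_eq_sub, vsub_eq_sub] at this
    rw [this]
    abel
  have hAinj : Function.Injective (A i) := fun x y hxy => by
    rw [hA, hA] at hxy
    have h1 : e (x - v) = e (y - v) := add_left_cancel hxy
    exact sub_left_injective (e.injective h1)
  have hTi : ∀ x, x ∈ T i ↔ M (x - v) ∈ G₀ := fun x => by
    have h1 : M (x - v) ∈ G₀ ↔ A i x ∈ G := by rw [hA, hG₀, mem_preimage]
    rw [h1, ← hT.image_eq i, hAinj.mem_set_image]
  -- The shift of `T i` to itself is chosen to be `0`, so that its digit is `0`.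
  have hexa : ∀ j, ∃ a, T j = (fun x => x + a) '' T i ∧ (j = i → a = 0) := fun j => by
    by_cases hj : j = i
    · exact ⟨0, by simp [hj], fun _ => rfl⟩
    · obtain ⟨a, ha⟩ := hT.translate i j
      exact ⟨a, ha, fun h => absurd h hj⟩
  choose a ha ha0 using hexa
  have hTj : ∀ j x, x ∈ T j ↔ M (x - v) - M (a j) ∈ G₀ := fun j x => by
    rw [ha j, image_add_right, mem_preimage, hTi, ← map_sub]
    have : x + -a j - v = x - v - a j := by abel
    rw [this]
  have hmem : ∀ z, z ∈ G₀ ↔ ∃ j, M z - M (a j) ∈ G₀ := fun z => by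
    have h1 : z ∈ G₀ ↔ v + z ∈ G := Iff.rfl
    rw [h1, ← hT.iUnion_eq, mem_iUnion]
    refine exists_congr fun j => ?_
    rw [hTj, add_sub_cancel_left]
  have hmapK : ∀ z, e z ∈ K ↔ z ∈ K := fun z => by
    have h1 : A i (v + z) ∈ cornerCone G v ↔ v + z ∈ cornerCone G v := by
      conv_lhs => rw [← hcone]
      exact hAinj.mem_set_image
    rwa [hcorner, hcorner, hA, add_sub_cancel_left, add_sub_cancel_left] at h1
  have hG₀K : G₀ ⊆ K := fun z hz => by
    have := hsub hz
    rwa [hcorner, add_sub_cancel_left] at this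
  have h0G₀ : (0 : EuclideanSpace ℝ (Fin d)) ∈ G₀ := by
    rw [hG₀, mem_preimage, add_zero]; exact hvG
  refine ⟨e.symm, fun j => M (a j), i, ?_, hG₀K, hlc.exists_mem_germCone_iff, ?_, ?_, ?_, ?_, ?_, ?_⟩
  · exact (Homeomorph.addLeft v).isCompact_preimage.2 hGc
  · intro x
    rw [← hmapK, e.apply_symm_apply]
  · exact fun R ε hε => hM.exists_iterate_lt
      (e.symm : EuclideanSpace ℝ (Fin d) →ₗ[ℝ] EuclideanSpace ℝ (Fin d))
      (fun x => e.apply_symm_apply x) R ε hε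
  · simp [ha0 i rfl]
  · intro j
    -- The copy of the apex in tile `j` is `a j`, so it lies in `G₀ ⊆ K`, and `M` preserves `K`.
    rw [← heM, hmapK]
    refine hG₀K ((hmem _).2 ⟨j, ?_⟩)
    rwa [sub_self]
  · intro j hji hzero
    -- Another zero digit would make two tiles coincide, hence be null; then all tiles, and `G`,
    -- would be null.
    have haj : a j = 0 := by
      rw [← heM] at hzero
      simpa using hzero
    have hTT : T j = T i := by rw [ha j, haj]; simp
    have hnull := hT.null_inter j i hji
    rw [hTT, inter_self] at hnull
    refine hT.volume_pos.ne' ?_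
    rw [← hT.iUnion_eq]
    refine measure_iUnion_null fun k => ?_
    rw [ha k, image_add_right, measure_preimage_add_right]
    exact hnull
  · have hdisj : ∀ p : Fin N × Fin N, ∀ᵐ x ∂(volume : Measure (EuclideanSpace ℝ (Fin d))),
        p.1 ≠ p.2 → ¬(x - M (a p.1) ∈ G₀ ∧ x - M (a p.2) ∈ G₀) := fun p => by
      by_cases hp : p.1 = p.2
      · exact Eventually.of_forall fun _ h => absurd hp h
      have h1 : ∀ᵐ x ∂(volume : Measure (EuclideanSpace ℝ (Fin d))), x ∉ T p.1 ∩ T p.2 :=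
        measure_eq_zero_iff_ae_notMem.1 (hT.null_inter p.1 p.2 hp)
      filter_upwards [ae_continuousLinearEquiv (ae_sub_right h1 (-v)) e.symm] with x hx _ hx2
      refine hx ⟨(hTj _ _).2 ?_, (hTj _ _).2 ?_⟩
      · rw [sub_neg_eq_add, add_sub_cancel_right, ← heM (e.symm x), e.apply_symm_apply]
        exact hx2.1
      · rw [sub_neg_eq_add, add_sub_cancel_right, ← heM (e.symm x), e.apply_symm_apply]
        exact hx2.2
    filter_upwards [ae_all_iff.2 hdisj] with x hx
    have hiff : e.symm x ∈ G₀ ↔ ∃ j, x - M (a j) ∈ G₀ := by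
      rw [hmem, ← heM (e.symm x), e.apply_symm_apply]
    by_cases hxG : e.symm x ∈ G₀
    · rw [indicator_of_mem hxG, sum_indicator_eq_one_of_existsUnique (hiff.1 hxG)
        fun p q hpq => hx (p, q) hpq]
      rfl
    · rw [indicator_of_notMem hxG, Finset.sum_eq_zero]
      exact fun j _ => indicator_of_notMem (fun h => hxG (hiff.2 ⟨j, h⟩)) _

lemma isSimpleCone_of_basisCone {d : ℕ} {C : Set (EuclideanSpace ℝ (Fin d))}
    {v : EuclideanSpace ℝ (Fin d)} (b : Module.Basis (Fin d) ℝ (EuclideanSpace ℝ (Fin d)))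
    (hC : ∀ x, x ∈ C ↔ x - v ∈ basisCone b) : IsSimpleCone C := by
  set L : EuclideanSpace ℝ (Fin d) ≃ₗ[ℝ] EuclideanSpace ℝ (Fin d) :=
    b.equivFun.trans (WithLp.linearEquiv 2 ℝ (Fin d → ℝ)).symm with hL
  have hLk : ∀ x k, L x k = b.repr x k := fun x k => by simp [hL]
  refine ⟨(AffineEquiv.constVAdd ℝ _ (-v)).trans L.toAffineEquiv, ?_⟩
  ext y
  constructor
  · rintro ⟨x, hx, rfl⟩ k
    have := (hC x).1 hx k
    simpa [hLk, neg_add_eq_sub] using this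
  · intro hy
    refine ⟨v + L.symm y, (hC _).2 fun k => ?_, by simp⟩
    rw [add_sub_cancel_left, ← hLk, L.apply_symm_apply]
    exact hy k

end Main

theorem proposition5 {d N : ℕ} (G : Set (EuclideanSpace ℝ (Fin d)))
    (T : Fin N → Set (EuclideanSpace ℝ (Fin d)))
    (A : Fin N → (EuclideanSpace ℝ (Fin d) →ᵃ[ℝ] EuclideanSpace ℝ (Fin d)))
    (hG : IsPolyhedralSet G) (hT : IsSelfAffineTiling G T A)
    (v : EuclideanSpace ℝ (Fin d)) (hv : IsStationaryVertex G T A v) :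
    Convex ℝ (cornerCone G v) ∧ IsSimpleCone (cornerCone G v) ∧
      ∃ r : ℝ, 0 < r ∧
        G ∩ Metric.closedBall v r = cornerCone G v ∩ Metric.closedBall v r := by
  obtain ⟨n, P, hP, hGP⟩ := hG
  choose hPc hPi m a c hPeq using hP
  have hGc : IsCompact G := by
    rw [hGP]
    exact isCompact_iUnion hPc
  set G₀ := (fun y => v + y) ⁻¹' G with hG₀
  have hpoly : ∀ k, {x | ∀ j, innerSL ℝ (a k j) x ≤ c k j - inner ℝ (a k j) v} =
      (Homeomorph.addLeft v) ⁻¹' P k := fun k => by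
    ext x
    rw [hPeq k]
    simp only [mem_ofPred_eq, mem_preimage, Homeomorph.coe_addLeft, inner_add_right,
      innerSL_apply_apply]
    exact forall_congr' fun j => by constructor <;> intro h <;> linarith
  obtain ⟨V, l, hK, hl, hlc⟩ := exists_isConicPolyhedralSet_germCone (G := G₀)
    (fun k j => innerSL ℝ (a k j)) (fun k j => c k j - inner ℝ (a k j) v)
    (fun k => by
      rw [hpoly]
      exact (Homeomorph.addLeft v).isCompact_preimage.2 (hPc k))
    (fun k => by
      rw [hpoly, ← Homeomorph.preimage_interior]
      exact (hPi k).preimage (Homeomorph.surjective _))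
    (by
      simp only [hpoly]
      rw [← preimage_iUnion, ← hGP]
      rfl)
    (zero_mem_extremePoints_preimage_add hv.1)
  obtain ⟨B, D, i₀, htile⟩ := exists_isConeTile hGc hT hv hlc
  obtain ⟨b', hb'⟩ := htile.exists_eq_basisCone hK hl (by
    rw [measure_preimage_add]
    exact hT.volume_pos.ne')
  set b := b'.reindex (finCongr (finrank_euclideanSpace_fin (𝕜 := ℝ) (n := d))) with hb
  have hbb : basisCone b' = basisCone b := by
    ext x
    simp only [basisCone, mem_ofPred_eq, hb, Module.Basis.repr_reindex_apply]
    refine ⟨fun h j => h _, fun h j => ?_⟩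
    simpa using h (finCongr (finrank_euclideanSpace_fin (𝕜 := ℝ) (n := d)) j)
  have hmem : ∀ x, x ∈ cornerCone G v ↔ x - v ∈ basisCone b := fun x => by
    rw [← hbb, ← hb']
    rfl
  refine ⟨?_, isSimpleCone_of_basisCone b hmem, ?_⟩
  · intro x hx y hy s t hs ht hst
    rw [hmem] at *
    intro k
    have e1 : s • x + t • y - v = s • (x - v) + t • (y - v) := by
      have : v = (s + t) • v := by rw [hst, one_smul]
      conv_lhs => rw [this]
      module
    rw [e1, map_add, map_smul, map_smul]
    exact add_nonneg (mul_nonneg hs (hx k)) (mul_nonneg ht (hy k))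
  · obtain ⟨r, hr, hrG⟩ := hlc.exists_mem_germCone_iff
    -- Halving `r` puts the closed ball inside the open one where `G₀` and its cone agree.
    refine ⟨r / 2, by positivity, ?_⟩
    ext x
    simp only [mem_inter_iff, mem_closedBall_iff_norm]
    refine and_congr_left fun hx => ?_
    have h1 := hrG (x - v) (by linarith)
    have h2 : x - v ∈ G₀ ↔ x ∈ G := by rw [hG₀, mem_preimage, add_sub_cancel]
    rw [← h2, ← h1]
    rfl
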